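/- Let $k$ be a nonarchimedean local field with ring of integers $\mathcal R$, maximal ideal $\mathcal P$, uniformizer $\varpi$, and residue field $\kappa$ of order $q$ and odd characteristic. Let $\varepsilon\in\mathcal R^\times$ be a nonsquare, and let $\Psi:k\to\mathbb C^\times$ be an additive character which is trivial on $\mathcal P$ and nontrivial on $\mathcal R$; write $\psi$ for the induced nontrivial character of $\kappa$. Let $\mathcal K=\mathrm{SL}_2(\mathcal R)$, with center $Z=\{\pm I\}$, and $U=\left\{\begin{pmatrix}1&b\\0&1\end{pmatrix}: b\in\mathcal R\right\}$. All representations are over $\mathbb C$. *The representations $\sigma_0^\pm$.* Let $\kappa'/\kappa$ be the quadratic extension, $N:\kappa'\to\kappa$ its norm, and $\omega_0$ the unique character of order $2$ of $\ker(N:\kappa'^\times\to\kappa^\times)$. Let $\sigma_0=\sigma(\omega_0)$ be the Deligne–Lusztig representation of $\mathrm{SL}_2(\kappa)$ of degree $q-1$ attached to $\omega_0$; its central character is $-1\mapsto\omega_0(-1)$. It decomposes as $\sigma_0=\sigma_0^+\oplus\sigma_0^-$, a direct sum of two inequivalent cuspidal representations of degree $(q-1)/2$, labelled so that the trace of $\begin{pmatrix}1&b\\0&1\end{pmatrix}$,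 $b\in\kappa^\times$, is $\sum_y\psi(by)$, where $y$ runs over the nonzero squares of $\kappa$ for $\sigma_0^+$ and over the nonsquares for $\sigma_0^-$. (In the classical realization on the $\omega_0$-isotypic functions on $\kappa'$ in the Weil representation of $(\kappa',N,\psi)$, $\sigma_0^{+}$ and $\sigma_0^-$ consist of the functions supported on elements whose norm is a nonzero square, respectively a nonsquare.) Inflate $\sigma_0^\pm$ to $\mathcal K$. *The representations $\pi_d^\pm(\theta)$.* Let $d>0$ be an integer, let $\mathcal B_d\subset\mathcal K$ be the subgroup of matrices whose lower left entry lies in $\mathcal P^d$, and let $\eta=\mathrm{diag}(1,\varpi)$, so that $(\sigma_0^\pm)^{\eta^d}(g)=\sigma_0^\pm(\eta^{-d}g\eta^d)$ is a representation of $\mathcal B_d$. Fix a character $\tau$ of $\kappa^\times$ with $\tau(-1)=-1$, viewed as the character $g\mapsto\tau(g_{11}\bmod\mathcal P)$ of $\mathcal B_d$. For a character $\theta$ of $Z$ put $$\pi_d^\pm(\theta)=\begin{cases}\mathrm{Ind}_{\mathcal B_d}^{\mathcal K}(\sigma_0^\pm)^{\eta^d}&\text{if }\theta\text{ coincides with the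 central character of }\sigma_0,\\ \mathrm{Ind}_{\mathcal B_d}^{\mathcal K}\,\tau(\sigma_0^\pm)^{\eta^d}&\text{otherwise.}\end{cases}$$ *The representations $\mathcal S_d(\theta,X)$.* For $u,v\in k$ with $\mathrm{val}(v)>\mathrm{val}(u)=-d$ let $X=X(u,v)=\begin{pmatrix}0&u\\v&0\end{pmatrix}$, let $T(X)$ be the centralizer of $X$ in $\mathcal K$, and let $$J_d=\left\{g\in\mathcal K:\ g_{11},g_{22}\in1+\mathcal P^{\lceil d/2\rceil},\ g_{12}\in\mathcal P^{\lceil d/2\rceil},\ g_{21}\in\mathcal P^{\lceil (d+1)/2\rceil}\right\},$$ on which $\Psi_X(g)=\Psi(\mathrm{Tr}(X(g-I)))$ is a character. If $\theta$ is a character of $T(X)$ which coincides with $\Psi_X$ on $T(X)\cap J_d$, let $\Psi_{\theta,X}$ be the unique character of $T(X)J_d$ extending $\theta$ and $\Psi_X$, and set $\mathcal S_d(\theta,X)=\mathrm{Ind}_{T(X)J_d}^{\mathcal K}\Psi_{\theta,X}$. When $v=0$ one has $T(X)=ZU$, and a character $\theta$ of $Z$ is regarded as a character of $T(X)$ by extending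 it trivially over $U$; it then coincides with $\Psi_X$ on $T(X)\cap J_d$. **Proposition.** For each integer $d>0$ and each character $\theta$ of $Z$, $$\pi_d^+(\theta)\cong\mathcal S_d(\theta,X(-\varpi^{-d},0))\quad\text{and}\quad \pi_d^-(\theta)\cong\mathcal S_d(\theta,X(-\varepsilon\varpi^{-d},0)).$$ Consequently, each $\mathcal K$-representation $\pi_d^\pm(\theta)$ is irreducible. -/

import Mathlib

open scoped MatrixGroups
open ValuativeRel

namespace DepthZero

noncomputable section

set_option linter.unusedSectionVars false
set_option linter.style.haveILetI false

section Finite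

variable {F E : Type*} [Field F] [Finite F] [Field E] [Fintype E] [Algebra F E]
  [Algebra.IsQuadraticExtension F E]

variable (F E) in
lemma conj_add (x y : E) : (x + y) ^ Nat.card F = x ^ Nat.card F + y ^ Nat.card F := by
  letI := Fintype.ofFinite F
  rw [Nat.card_eq_fintype_card]
  exact map_add (FiniteField.frobeniusAlgHom F E) x y

lemma conj_algebraMap (a : F) : (algebraMap F E a) ^ Nat.card F = algebraMap F E a := by
  letI := Fintype.ofFinite F
  rw [Nat.card_eq_fintype_card, ← map_pow, FiniteField.pow_card]

variable (F E) in
lemma conj_conj (x : E) : (x ^ Nat.card F) ^ Nat.card F = x := by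
  rw [← pow_mul, ← sq]
  have h : Nat.card F ^ 2 = Fintype.card E := by
    letI := Fintype.ofFinite F
    rw [Nat.card_eq_fintype_card, Module.card_eq_pow_finrank (K := F) (V := E),
      Algebra.IsQuadraticExtension.finrank_eq_two]
  rw [h, FiniteField.pow_card]

/-- The pairing `Tr_{E/F}(x ȳ)`, where `ȳ = y ^ |F|` is the conjugate of `y` over `F`. -/
def pairing (x y : E) : F := Algebra.trace F E (x * y ^ Nat.card F)

lemma algebraMap_norm (x : E) : algebraMap F E (Algebra.norm F x) = x * x ^ Nat.card F := by
  rw [FiniteField.algebraMap_norm_eq_pow_sum, Algebra.IsQuadraticExtension.finrank_eq_two]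
  simp [Finset.sum_range_succ, pow_add]

lemma algebraMap_pairing (x y : E) :
    algebraMap F E (pairing x y) = x * y ^ Nat.card F + x ^ Nat.card F * y := by
  rw [pairing, FiniteField.algebraMap_trace_eq_sum_pow,
    Algebra.IsQuadraticExtension.finrank_eq_two]
  simp [Finset.sum_range_succ, mul_pow, conj_conj]

lemma norm_add (x y : E) :
    Algebra.norm F (x + y) = Algebra.norm F x + pairing x y + Algebra.norm F y := by
  apply (algebraMap F E).injective
  simp only [map_add, algebraMap_norm, algebraMap_pairing, conj_add]
  ring

lemma norm_algebraMap_mul (a : F) (x : E) :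
    Algebra.norm F (algebraMap F E a * x) = a ^ 2 * Algebra.norm F x := by
  rw [map_mul, Algebra.norm_algebraMap, Algebra.IsQuadraticExtension.finrank_eq_two]

lemma pairing_smul_left (a : F) (x y : E) :
    pairing (algebraMap F E a * x) y = a * pairing x y := by
  apply (algebraMap F E).injective
  simp only [map_mul, algebraMap_pairing, mul_pow, conj_algebraMap]
  ring

lemma pairing_smul_right (a : F) (x y : E) :
    pairing x (algebraMap F E a * y) = a * pairing x y := by
  apply (algebraMap F E).injective
  simp only [map_mul, algebraMap_pairing, mul_pow, conj_algebraMap]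
  ring

lemma pairing_add_left (x y z : E) :
    pairing (F := F) (x + y) z = pairing x z + pairing y z := by
  apply (algebraMap F E).injective
  simp only [map_add, algebraMap_pairing, conj_add]
  ring

lemma pairing_add_right (x y z : E) :
    pairing (F := F) x (y + z) = pairing x y + pairing x z := by
  apply (algebraMap F E).injective
  simp only [map_add, algebraMap_pairing, conj_add]
  ring

lemma pairing_comm (x y : E) : pairing (F := F) x y = pairing y x := by
  apply (algebraMap F E).injective
  simp only [algebraMap_pairing]
  ring

lemma pairing_neg_left (x y : E) : pairing (F := F) (-x) y = -pairing x y := by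
  have := pairing_smul_left (-1 : F) x y
  simpa using this

lemma norm_neg' (x : E) : Algebra.norm F (-x) = Algebra.norm F x := by
  simpa using norm_algebraMap_mul (-1 : F) x

variable {ψ : AddChar F ℂ}

/-- Sums of a nontrivial additive character over the norm form of a quadratic extension. -/
lemma sum_norm (hψ : ψ ≠ 1) {a : F} (ha : a ≠ 0) :
    ∑ y : E, ψ (a * Algebra.norm F y) = -(Nat.card F : ℂ) := by
  classical
  letI := Fintype.ofFinite F
  rw [Nat.card_eq_fintype_card]
  have hind : ∀ b : F, b ≠ 0 → ∑ y : E, ψ (b * Algebra.norm F y) =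
      ∑ y : E, ψ (a * Algebra.norm F y) := by
    intro b hb
    obtain ⟨s, hs⟩ := FiniteField.norm_surjective F E (b / a)
    have hs0 : s ≠ 0 := by
      rintro rfl
      rw [Algebra.norm_zero] at hs
      exact div_ne_zero hb ha hs.symm
    refine Fintype.sum_equiv (Equiv.mulLeft₀ s hs0) _ _ fun y => ?_
    simp only [Equiv.mulLeft₀_apply, map_mul, hs]
    congr 1
    field_simp
  have htot : ∑ b : F, ∑ y : E, ψ (b * Algebra.norm F y) = Fintype.card F := by
    rw [Finset.sum_comm]
    have : ∀ y : E, ∑ b : F, ψ (b * Algebra.norm F y) =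
        if y = 0 then (Fintype.card F : ℂ) else 0 := by
      intro y
      rw [AddChar.sum_mulShift _ (AddChar.IsPrimitive.of_ne_one hψ)]
      simp [Algebra.norm_eq_zero_iff]
    simp [this]
  rw [← Finset.add_sum_erase _ _ (Finset.mem_univ (0 : F)),
    Finset.sum_congr rfl (fun b hb => hind b (Finset.ne_of_mem_erase hb))] at htot
  have hE : Fintype.card E = Fintype.card F ^ 2 := by
    rw [Module.card_eq_pow_finrank (K := F) (V := E),
      Algebra.IsQuadraticExtension.finrank_eq_two]
  have h1 : (Fintype.card F : ℂ) - 1 ≠ 0 := by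
    have : 1 < Fintype.card F := Fintype.one_lt_card
    rw [sub_ne_zero]
    exact_mod_cast this.ne'
  simp only [zero_mul, AddChar.map_zero_eq_one, Finset.sum_const, Finset.card_univ, hE,
    Finset.card_erase_of_mem (Finset.mem_univ _), nsmul_eq_mul, mul_one] at htot
  rw [Nat.cast_sub (Fintype.card_pos)] at htot
  push_cast at htot
  apply mul_left_cancel₀ h1
  linear_combination htot

/-- Completing the square. -/
lemma sum_norm_pairing (hψ : ψ ≠ 1) {a : F} (ha : a ≠ 0) (w : E) :
    ∑ y : E, ψ (a * Algebra.norm F y - pairing w y) =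
      -(Nat.card F : ℂ) * ψ (-(Algebra.norm F w / a)) := by
  rw [← sum_norm (E := E) hψ ha, Finset.sum_mul]
  refine Fintype.sum_equiv (Equiv.subRight (algebraMap F E a⁻¹ * w)) _ _ fun y => ?_
  rw [← AddChar.map_add_eq_mul]
  congr 1
  have : y = Equiv.subRight (algebraMap F E a⁻¹ * w) y + algebraMap F E a⁻¹ * w := by simp
  generalize Equiv.subRight (algebraMap F E a⁻¹ * w) y = z at this ⊢
  subst this
  rw [norm_add, pairing_add_right, norm_algebraMap_mul, pairing_smul_right, pairing_smul_right,
    pairing_comm z w]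
  have : pairing (F := F) w w = 2 * Algebra.norm F w := by
    apply (algebraMap F E).injective
    simp only [map_mul, algebraMap_pairing, algebraMap_norm, map_ofNat]
    ring
  rw [this]
  field_simp
  ring

/-- Orthogonality of the characters `y ↦ ψ(Tr(w ȳ))`. -/
lemma sum_pairing (hψ : ψ ≠ 1) [DecidableEq E] (w : E) :
    ∑ y : E, ψ (- pairing w y) = if w = 0 then (Nat.card F : ℂ) ^ 2 else 0 := by
  split_ifs with hw
  · subst hw
    have hE : Fintype.card E = Nat.card F ^ 2 := by
      letI := Fintype.ofFinite F
      rw [Nat.card_eq_fintype_card, Module.card_eq_pow_finrank (K := F) (V := E),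
        Algebra.IsQuadraticExtension.finrank_eq_two]
    simp [pairing, hE]
  · let φ : AddChar E ℂ :=
      { toFun := fun y => ψ (-pairing w y)
        map_zero_eq_one' := by
          have : pairing (F := F) w 0 = 0 := by simpa using pairing_smul_right (0 : F) w 0
          simp [this]
        map_add_eq_mul' := fun y z => by
          rw [← AddChar.map_add_eq_mul, pairing_add_right, neg_add] }
    refine AddChar.sum_eq_zero_of_ne_one (ψ := φ) fun h => ?_
    obtain ⟨t, ht⟩ : ∃ t, ψ t ≠ 1 := by
      by_contra! h'
      exact hψ (by ext; simp [h'])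
    have hs : Function.Surjective (Algebra.trace F E) := Algebra.trace_surjective F E
    obtain ⟨z, hz⟩ := hs (-t)
    apply ht
    have := DFunLike.congr_fun h ((z / w) ^ Nat.card F)
    change ψ (-pairing w ((z / w) ^ Nat.card F)) = 1 at this
    rwa [pairing, conj_conj, mul_div_cancel₀ _ hw, hz, neg_neg] at this

/-- The operator by which `g ∈ SL₂(F)` acts in the Weil representation attached to `ψ` and to
the norm form of `E/F`. -/
def weilOp (ψ : AddChar F ℂ) (g : SL(2, F)) (f : E → ℂ) (x : E) : ℂ :=
  open Classical in
  if g 1 0 = 0 then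
    ψ (g 0 0 * g 0 1 * Algebra.norm F x) * f (algebraMap F E (g 0 0) * x)
  else
    -(Nat.card F : ℂ)⁻¹ * ∑ y : E,
      ψ ((g 0 0 * Algebra.norm F x - pairing x y + g 1 1 * Algebra.norm F y) / g 1 0) * f y

lemma weilOp_one (f : E → ℂ) : weilOp ψ (1 : SL(2, F)) f = f := by
  ext x
  simp [weilOp]

lemma weilOp_of_eq {g : SL(2, F)} (hg : g 1 0 = 0) (f : E → ℂ) (x : E) :
    weilOp ψ g f x =
      ψ (g 0 0 * g 0 1 * Algebra.norm F x) * f (algebraMap F E (g 0 0) * x) := by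
  simp [weilOp, hg]

lemma weilOp_of_ne {g : SL(2, F)} (hg : g 1 0 ≠ 0) (f : E → ℂ) (x : E) :
    weilOp ψ g f x = -(Nat.card F : ℂ)⁻¹ * ∑ y : E,
      ψ ((g 0 0 * Algebra.norm F x - pairing x y + g 1 1 * Algebra.norm F y) / g 1 0) * f y := by
  simp [weilOp, hg]

lemma weilOp_mul (hψ : ψ ≠ 1) (g h : SL(2, F)) (f : E → ℂ) :
    weilOp ψ (g * h) f = weilOp ψ g (weilOp ψ h f) := by
  classical
  ext x
  have hg1 := Matrix.det_fin_two g.1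
  have hh1 := Matrix.det_fin_two h.1
  rw [g.2] at hg1
  rw [h.2] at hh1
  have e00 : (g * h) 0 0 = g 0 0 * h 0 0 + g 0 1 * h 1 0 := by
    simp [Matrix.SpecialLinearGroup.coe_mul, Matrix.mul_apply, Fin.sum_univ_two]
  have e01 : (g * h) 0 1 = g 0 0 * h 0 1 + g 0 1 * h 1 1 := by
    simp [Matrix.SpecialLinearGroup.coe_mul, Matrix.mul_apply, Fin.sum_univ_two]
  have e10 : (g * h) 1 0 = g 1 0 * h 0 0 + g 1 1 * h 1 0 := by
    simp [Matrix.SpecialLinearGroup.coe_mul, Matrix.mul_apply, Fin.sum_univ_two]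
  have e11 : (g * h) 1 1 = g 1 0 * h 0 1 + g 1 1 * h 1 1 := by
    simp [Matrix.SpecialLinearGroup.coe_mul, Matrix.mul_apply, Fin.sum_univ_two]
  change 1 = g 0 0 * g 1 1 - g 0 1 * g 1 0 at hg1
  change 1 = h 0 0 * h 1 1 - h 0 1 * h 1 0 at hh1
  have hq : (Nat.card F : ℂ) ≠ 0 := by
    exact_mod_cast Nat.card_pos.ne'
  by_cases hg : g 1 0 = 0
  · have hg0 : g 0 0 ≠ 0 := by
      intro h0
      simp [h0, hg] at hg1
    have hg11 : g 1 1 = (g 0 0)⁻¹ := by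
      rw [hg] at hg1
      field_simp
      linear_combination -hg1
    rw [weilOp_of_eq hg]
    by_cases hh : h 1 0 = 0
    · rw [weilOp_of_eq hh, weilOp_of_eq (by rw [e10, hg, hh]; ring), ← mul_assoc,
        ← AddChar.map_add_eq_mul, norm_algebraMap_mul, e00, e01, hh, ← mul_assoc (algebraMap F E _),
        ← map_mul]
      have hh11 : h 0 0 * h 1 1 = 1 := by rw [hh] at hh1; linear_combination -hh1
      congr 2
      · linear_combination (g 0 0 * g 0 1 * Algebra.norm F x) * hh11
      · congr 1
        congr 1
        ring
    · have hne : (g * h) 1 0 ≠ 0 := by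
        rw [e10, hg, zero_mul, zero_add, hg11]
        exact mul_ne_zero (inv_ne_zero hg0) hh
      rw [weilOp_of_ne hh, weilOp_of_ne hne, mul_left_comm (ψ _), Finset.mul_sum (a := ψ _)]
      congr 1
      refine Finset.sum_congr rfl fun y _ => ?_
      rw [← mul_assoc, ← AddChar.map_add_eq_mul, norm_algebraMap_mul, pairing_smul_left, e00, e10,
        e11, hg, hg11, zero_mul, zero_mul, zero_add, zero_add]
      congr 2
      field_simp
      ring
  · rw [weilOp_of_ne hg]
    by_cases hh : h 1 0 = 0
    · have hh0 : h 0 0 ≠ 0 := by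
        intro h0
        simp [h0, hh] at hh1
      have hh11 : h 1 1 = (h 0 0)⁻¹ := by
        rw [hh] at hh1
        field_simp
        linear_combination -hh1
      have hne : (g * h) 1 0 ≠ 0 := by
        rw [e10, hh, mul_zero, add_zero]
        exact mul_ne_zero hg hh0
      rw [weilOp_of_ne hne]
      congr 1
      have hm : algebraMap F E (h 0 0) ≠ 0 := by simpa using hh0
      symm
      refine Fintype.sum_equiv (Equiv.mulLeft₀ _ hm) _ _ fun y => ?_
      rw [weilOp_of_eq hh, Equiv.mulLeft₀_apply, ← mul_assoc, ← AddChar.map_add_eq_mul,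
        norm_algebraMap_mul, pairing_smul_right, e00, e10, e11, hh, hh11]
      congr 2
      field_simp
      ring
    · -- both lower left entries are nonzero: compute the composed kernel
      set α : F := g 1 1 / g 1 0 + h 0 0 / h 1 0 with hα
      have hα' : (g * h) 1 0 = g 1 0 * h 1 0 * α := by
        rw [e10, hα]
        field_simp
        ring
      have hker : weilOp ψ g (weilOp ψ h f) x = ((Nat.card F : ℂ)⁻¹) ^ 2 * ∑ z : E,
          ψ (g 0 0 * Algebra.norm F x / g 1 0 + h 1 1 * Algebra.norm F z / h 1 0) *
            (∑ y : E, ψ (α * Algebra.norm F y -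
              pairing (algebraMap F E (g 1 0)⁻¹ * x + algebraMap F E (h 1 0)⁻¹ * z) y)) * f z := by
        rw [weilOp_of_ne hg]
        simp only [weilOp_of_ne hh, Finset.mul_sum, Finset.sum_mul]
        rw [Finset.sum_comm]
        refine Finset.sum_congr rfl fun z _ => Finset.sum_congr rfl fun y _ => ?_
        rw [pairing_add_left, pairing_smul_left, pairing_smul_left, pairing_comm z y]
        have : ∀ a b c d : F, ∀ u v : ℂ, a + b = c + d →
            -u * (ψ a * (-u * (ψ b * v))) = u ^ 2 * (ψ c * ψ d * v) := by
          intro a b c d u v h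
          rw [← AddChar.map_add_eq_mul ψ c d, ← h, AddChar.map_add_eq_mul]
          ring
        apply this
        rw [hα]
        field_simp
        ring
      rw [← weilOp_of_ne hg, hker]
      by_cases hα0 : α = 0
      · have h10 : (g * h) 1 0 = 0 := by rw [hα', hα0, mul_zero]
        have ha : (g * h) 0 0 = -(h 1 0 / g 1 0) := by
          rw [e10] at h10
          rw [e00]
          field_simp
          linear_combination (g 0 0) * h10 + h 1 0 * hg1
        have hd : (g * h) 0 1 = g 0 0 * h 0 1 + g 0 1 * h 1 1 := e01
        rw [weilOp_of_eq h10]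
        have hsum : ∀ z : E, (∑ y : E, ψ (α * Algebra.norm F y -
              pairing (algebraMap F E (g 1 0)⁻¹ * x + algebraMap F E (h 1 0)⁻¹ * z) y)) =
              if z = algebraMap F E ((g * h) 0 0) * x then (Nat.card F : ℂ) ^ 2 else 0 := by
          intro z
          simp only [hα0, zero_mul, zero_sub]
          rw [sum_pairing hψ]
          congr 1
          rw [ha, eq_iff_iff]
          have h1 : algebraMap F E (g 1 0) ≠ 0 := by simpa using hg
          have h2 : algebraMap F E (h 1 0) ≠ 0 := by simpa using hh
          simp only [map_neg, map_div₀, map_inv₀]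
          constructor
          · intro h'
            field_simp at h' ⊢
            linear_combination h'
          · rintro rfl
            field_simp
            ring
        simp only [hsum]
        simp only [mul_ite, ite_mul, mul_zero, zero_mul, Finset.sum_ite_eq',
          Finset.mem_univ, if_true]
        have : ∀ u v : ℂ, (Nat.card F : ℂ)⁻¹ ^ 2 * (u * (Nat.card F : ℂ) ^ 2 * v) = u * v := by
          intro u v
          field_simp
        rw [this, norm_algebraMap_mul]
        congr 2
        rw [e10] at h10
        rw [ha, e01]
        field_simp
        linear_combination -(Algebra.norm F x * g 1 0 * g 0 0) * hh1 -
          (Algebra.norm F x * h 1 0 * h 1 1) * hg1 - (Algebra.norm F x * g 0 0 * h 1 1) * h10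
      · have hne : (g * h) 1 0 ≠ 0 := by
          rw [hα']
          exact mul_ne_zero (mul_ne_zero hg hh) hα0
        rw [weilOp_of_ne hne, Finset.mul_sum, Finset.mul_sum]
        refine Finset.sum_congr rfl fun z _ => ?_
        rw [sum_norm_pairing hψ hα0]
        have : ∀ a b c : F, ∀ v : ℂ, a = b + c →
            -(Nat.card F : ℂ)⁻¹ * (ψ a * v) =
              (Nat.card F : ℂ)⁻¹ ^ 2 * (ψ b * (-(Nat.card F : ℂ) * ψ c) * v) := by
          intro a b c v h'
          rw [h', AddChar.map_add_eq_mul]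
          field_simp
        apply this
        rw [norm_add, norm_algebraMap_mul, norm_algebraMap_mul, pairing_smul_left,
          pairing_smul_right, hα', e00, e11]
        have hα2 : α * (g 1 0 * h 1 0) = g 1 1 * h 1 0 + g 1 0 * h 0 0 := by
          rw [hα]
          field_simp
        clear_value α
        field_simp
        linear_combination -(g 0 0 * h 1 0 * Algebra.norm F x + g 1 0 * h 1 1 * Algebra.norm F z) *
          hα2 + (Algebra.norm F x * h 1 0 ^ 2) * hg1 + (Algebra.norm F z * g 1 0 ^ 2) * hh1

lemma weilOp_add (g : SL(2, F)) (f₁ f₂ : E → ℂ) :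
    weilOp ψ g (f₁ + f₂) = weilOp ψ g f₁ + weilOp ψ g f₂ := by
  ext x
  by_cases hg : g 1 0 = 0
  · simp [weilOp_of_eq hg, mul_add]
  · simp [weilOp_of_ne hg, mul_add, Finset.sum_add_distrib]

lemma weilOp_smul (g : SL(2, F)) (c : ℂ) (f : E → ℂ) :
    weilOp ψ g (c • f) = c • weilOp ψ g f := by
  ext x
  by_cases hg : g 1 0 = 0
  · simp [weilOp_of_eq hg, mul_left_comm]
  · simp [weilOp_of_ne hg, Finset.mul_sum, mul_left_comm]

/-- The space of functions on `E`, on which the Weil representation acts. -/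
def WeilSpace (E : Type*) : Type _ := E → ℂ

instance (E : Type*) : AddCommGroup (WeilSpace E) := inferInstanceAs (AddCommGroup (E → ℂ))

instance (E : Type*) : Module ℂ (WeilSpace E) := inferInstanceAs (Module ℂ (E → ℂ))

instance (E : Type*) : CoeFun (WeilSpace E) fun _ => E → ℂ := ⟨fun f => f⟩

@[simp] lemma WeilSpace.add_apply (f₁ f₂ : WeilSpace E) (x : E) :
    (f₁ + f₂) x = f₁ x + f₂ x := rfl

@[simp] lemma WeilSpace.smul_apply (c : ℂ) (f : WeilSpace E) (x : E) :
    (c • f) x = c * f x := rfl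

@[simp] lemma WeilSpace.zero_apply (x : E) : (0 : WeilSpace E) x = 0 := rfl

/-- The Weil representation of `SL₂(F)` on functions on `E`. -/
def weilRep (ψ : AddChar F ℂ) (hψ : ψ ≠ 1) : Representation ℂ SL(2, F) (WeilSpace E) where
  toFun g :=
    { toFun := weilOp ψ g
      map_add' := weilOp_add g
      map_smul' := weilOp_smul g }
  map_one' := by
    ext1 f
    exact weilOp_one f
  map_mul' g h := by
    ext1 f
    exact weilOp_mul hψ g h f

variable (F E) in
/-- The kernel of the norm map `Eˣ → Fˣ`. -/
abbrev normKer : Subgroup Eˣ := (Units.map (Algebra.norm F : E →* F)).ker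

lemma norm_normKer (t : normKer F E) : Algebra.norm F ((t : Eˣ) : E) = 1 := by
  have := t.2
  rw [MonoidHom.mem_ker, Units.ext_iff] at this
  exact this

lemma conj_normKer (t : normKer F E) : ((t : Eˣ) : E) * ((t : Eˣ) : E) ^ Nat.card F = 1 := by
  rw [← algebraMap_norm (F := F), norm_normKer, map_one]

lemma pairing_normKer (t : normKer F E) (x y : E) :
    pairing (F := F) ((t : Eˣ) * x) ((t : Eˣ) * y) = pairing x y := by
  apply (algebraMap F E).injective
  simp only [algebraMap_pairing, mul_pow]
  linear_combination (x * y ^ Nat.card F + x ^ Nat.card F * y) * conj_normKer t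

/-- Multiplication by an element of the kernel of the norm. -/
lemma weilOp_normKer (g : SL(2, F)) (f : E → ℂ) (c : ℂ) (t : normKer F E)
    (hf : ∀ x : E, f ((t : Eˣ) * x) = c * f x) (x : E) :
    weilOp ψ g f ((t : Eˣ) * x) = c * weilOp ψ g f x := by
  by_cases hg : g 1 0 = 0
  · rw [weilOp_of_eq hg, weilOp_of_eq hg, map_mul (Algebra.norm F), norm_normKer, one_mul,
      mul_left_comm (algebraMap F E _), hf, mul_left_comm]
  · rw [weilOp_of_ne hg, weilOp_of_ne hg, mul_left_comm c, Finset.mul_sum (a := c)]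
    congr 1
    symm
    refine Fintype.sum_equiv (Units.mulLeft (t : Eˣ)) _ _ fun y => ?_
    rw [Units.mulLeft_apply, pairing_normKer, map_mul, map_mul, norm_normKer, hf]
    simp only [one_mul]
    ring

/-- For a nontrivial character `ω` of the kernel of the norm of `E/F`, the Deligne-Lusztig
representation `σ(ω)` of `SL₂(F)`, of degree `|F| - 1`, in its classical realization on the
`ω`-isotypic part of the Weil representation attached to the norm form of `E/F`. -/
def sigma (ψ : AddChar F ℂ) (hψ : ψ ≠ 1) (ω : normKer F E →* ℂˣ) :
    Subrepresentation (weilRep (E := E) ψ hψ) where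
  toSubmodule :=
    { carrier := {f : WeilSpace E | ∀ (t : normKer F E) (x : E), f ((t : Eˣ) * x) = ω t * f x}
      add_mem' := fun {f₁ f₂} h₁ h₂ t x => by
        simp only [WeilSpace.add_apply, h₁ t x, h₂ t x, mul_add]
      zero_mem' := fun t x => by simp
      smul_mem' := fun c f h t x => by
        simp only [WeilSpace.smul_apply, h t x, mul_left_comm] }
  apply_mem_toSubmodule g f hf t x := weilOp_normKer g f _ t (hf t) x

/-- `a` is nonzero and its quadratic residue symbol is the sign `s`. -/
def HasSign (s : ℤˣ) (a : F) : Prop := a ≠ 0 ∧ (IsSquare a ↔ s = 1)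

lemma HasSign.sq_mul {s : ℤˣ} {a b : F} (h : HasSign s (a ^ 2 * b)) (ha : a ≠ 0) :
    HasSign s b := by
  refine ⟨right_ne_zero_of_mul h.1, ?_⟩
  rw [← h.2]
  constructor
  · rintro ⟨c, rfl⟩
    exact ⟨a * c, by ring⟩
  · rintro ⟨c, hc⟩
    exact ⟨c / a, by field_simp; linear_combination hc⟩

lemma isSquare_mul_of_not {a b : F} (ha : ¬ IsSquare a)
    (hb : ¬ IsSquare b) : IsSquare (a * b) := by
  classical
  letI := Fintype.ofFinite F
  have ha0 : a ≠ 0 := by rintro rfl; exact ha (IsSquare.zero)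
  have hb0 : b ≠ 0 := by rintro rfl; exact hb (IsSquare.zero)
  rw [← quadraticChar_one_iff_isSquare (mul_ne_zero ha0 hb0), map_mul,
    quadraticChar_neg_one_iff_not_isSquare.2 ha, quadraticChar_neg_one_iff_not_isSquare.2 hb]
  norm_num

lemma isSquare_of_mul {a b : F} (ha0 : a ≠ 0) (ha : IsSquare a) (hab : IsSquare (a * b)) :
    IsSquare b := by
  obtain ⟨c, rfl⟩ := ha
  obtain ⟨e, he⟩ := hab
  have hc : c ≠ 0 := by rintro rfl; simp at ha0
  exact ⟨e / c, by field_simp; linear_combination he⟩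

/-- Every element of the kernel of the norm is of the form `ȳ / y`. -/
lemma normKer_exists (h2 : ringChar F ≠ 2) (t : normKer F E) :
    ∃ y : Eˣ, ((t : Eˣ) : E) * y = (y : E) ^ Nat.card F := by
  have hcard : ∃ a : E, a ^ Nat.card F ≠ a := by
    by_contra! h
    have h2' : (2 : F) ≠ 0 := Ring.two_ne_zero h2
    have h2E : (2 : E) ≠ 0 := by
      rw [← map_ofNat (algebraMap F E) 2]
      simpa using h2'
    have hsurj : Function.Surjective (algebraMap F E) := by
      intro a
      refine ⟨pairing a 1 / 2, ?_⟩
      rw [map_div₀, algebraMap_pairing, h a, map_ofNat]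
      field_simp
      ring
    have := Nat.card_le_card_of_surjective _ hsurj
    have hE : Nat.card E = Nat.card F ^ 2 := by
      rw [Module.natCard_eq_pow_finrank (K := F) (V := E),
        Algebra.IsQuadraticExtension.finrank_eq_two]
    have h1 : 1 < Nat.card F := Finite.one_lt_card
    nlinarith
  obtain ⟨a, ha⟩ : ∃ a : E, a + ((t : Eˣ) : E) ^ Nat.card F * a ^ Nat.card F ≠ 0 := by
    by_contra! h
    obtain ⟨b, hb⟩ := hcard
    have h1 := h 1
    have hb' := h b
    rw [one_pow, mul_one] at h1
    apply hb
    linear_combination -hb' + b ^ Nat.card F * h1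
  refine ⟨Units.mk0 _ ha, ?_⟩
  simp only [Units.val_mk0, conj_add, mul_pow, conj_conj]
  linear_combination a ^ Nat.card F * conj_normKer t

lemma quadratic_apply_square {ω : normKer F E →* ℂˣ} (hω2 : ω ^ 2 = 1)
    {z : Eˣ} (hz : IsSquare (Algebra.norm F (z : E))) {t : normKer F E}
    (ht : ((t : Eˣ) : E) * (z : E) ^ Nat.card F = z) : ω t = 1 := by
  obtain ⟨c, hc⟩ := hz
  have hc0 : c ≠ 0 := by
    rintro rfl
    rw [mul_zero, Algebra.norm_eq_zero_iff] at hc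
    exact z.ne_zero hc
  have hcE : algebraMap F E c ≠ 0 := by simpa using hc0
  have hv : Algebra.norm F (algebraMap F E c⁻¹ * z) = 1 := by
    rw [norm_algebraMap_mul, hc]
    field_simp
  have hv0 : algebraMap F E c⁻¹ * z ≠ 0 := mul_ne_zero (by simpa using hc0) z.ne_zero
  let v : normKer F E := ⟨Units.mk0 _ hv0, by
    rw [MonoidHom.mem_ker]
    ext
    exact hv⟩
  have htv : t = v ^ 2 := by
    apply Subtype.ext
    apply Units.ext
    change ((t : Eˣ) : E) = (algebraMap F E c⁻¹ * z) ^ 2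
    have hN := algebraMap_norm (F := F) (z : E)
    rw [hc, map_mul] at hN
    rw [map_inv₀]
    field_simp
    have hz0 := pow_ne_zero (Nat.card F) z.ne_zero
    linear_combination ((t : Eˣ) : E) * hN + (z : E) * ht
  rw [htv, map_pow, ← MonoidHom.pow_apply, hω2, MonoidHom.one_apply]

/-- The quadratic character of the kernel of the norm is `-1` on `z / z̄` if the norm of `z` is a
nonsquare. -/
lemma quadratic_apply (h2 : ringChar F ≠ 2) {ω : normKer F E →* ℂˣ} (hω : ω ≠ 1) (hω2 : ω ^ 2 = 1)
    {z : Eˣ} (hz : ¬ IsSquare (Algebra.norm F (z : E))) {t : normKer F E}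
    (ht : ((t : Eˣ) : E) * (z : E) ^ Nat.card F = z) : ω t = -1 := by
  have hsq : ((ω t : ℂˣ) : ℂ) ^ 2 = 1 := by
    have := DFunLike.congr_fun hω2 t
    rw [MonoidHom.pow_apply, MonoidHom.one_apply, Units.ext_iff] at this
    exact this
  rcases mul_self_eq_one_iff.1 ((sq _).symm.trans hsq) with h | h
  · exfalso
    apply hω
    ext u
    congr 1
    change ω u = 1
    have hωt : ω t = 1 := Units.ext h
    obtain ⟨y, hy⟩ := normKer_exists h2 u
    have hu : (((u⁻¹ : normKer F E) : Eˣ) : E) * (y : E) ^ Nat.card F = y := by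
      rw [← hy]
      simp
    by_cases hsy : IsSquare (Algebra.norm F (y : E))
    · have := quadratic_apply_square hω2 hsy hu
      simpa using this
    · have hyz : IsSquare (Algebra.norm F ((y * z : Eˣ) : E)) := by
        rw [Units.val_mul, map_mul]
        exact isSquare_mul_of_not hsy hz
      have := quadratic_apply_square (t := u⁻¹ * t) hω2 hyz (by
        simp only [Subgroup.coe_mul, Units.val_mul, mul_pow]
        linear_combination ((t : Eˣ) : E) * (z : E) ^ Nat.card F * hu + (y : E) * ht)
      rw [map_mul, hωt, mul_one] at this
      simpa using this
  · exact Units.ext h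

lemma sum_support (h2 : ringChar F ≠ 2) {ω : normKer F E →* ℂˣ} (hω : ω ≠ 1) (hω2 : ω ^ 2 = 1)
    (s : ℤˣ) (g : SL(2, F)) {f : E → ℂ}
    (hf : ∀ (t : normKer F E) (x : E), f ((t : Eˣ) * x) = ω t * f x)
    (hs : ∀ x, ¬ HasSign s (Algebra.norm F x) → f x = 0) (x : E)
    (hx : ¬ HasSign s (Algebra.norm F x)) : weilOp ψ g f x = 0 := by
  by_cases hg : g 1 0 = 0
  · rw [weilOp_of_eq hg, hs, mul_zero]
    rw [norm_algebraMap_mul]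
    intro h
    have h0 : g 0 0 ≠ 0 := by
      intro h0
      apply h.1
      rw [h0]
      ring
    exact hx (h.sq_mul h0)
  · rw [weilOp_of_ne hg]
    refine mul_eq_zero_of_right _ ?_
    by_cases hx0 : x = 0
    · subst hx0
      obtain ⟨t, ht⟩ : ∃ t, ω t ≠ 1 := by
        by_contra! h
        exact hω (MonoidHom.ext h)
      have ht' : ((ω t : ℂˣ) : ℂ) ≠ 1 := fun h => ht (Units.ext h)
      have h0 : ∀ y : E, pairing (F := F) 0 y = 0 := fun y => by simp [pairing]
      have key : ∑ y : E, ψ ((g 0 0 * Algebra.norm F (0 : E) - pairing 0 y +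
            g 1 1 * Algebra.norm F y) / g 1 0) * f y =
          (ω t : ℂ) * ∑ y : E, ψ ((g 0 0 * Algebra.norm F (0 : E) - pairing 0 y +
            g 1 1 * Algebra.norm F y) / g 1 0) * f y := by
        rw [Finset.mul_sum]
        symm
        refine Fintype.sum_equiv (Units.mulLeft (t : Eˣ)) _ _ fun y => ?_
        rw [Units.mulLeft_apply, map_mul (Algebra.norm F), norm_normKer, hf, h0, h0, one_mul]
        ring
      have : (1 - (ω t : ℂ)) * ∑ y : E, ψ ((g 0 0 * Algebra.norm F (0 : E) - pairing 0 y +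
            g 1 1 * Algebra.norm F y) / g 1 0) * f y = 0 := by
        linear_combination key
      exact (mul_eq_zero.1 this).resolve_left (sub_ne_zero.2 ht'.symm)
    · have hq0 : Nat.card F ≠ 0 := Nat.card_pos.ne'
      have hxc : x ^ Nat.card F ≠ 0 := pow_ne_zero _ hx0
      have hinv : Function.Involutive fun y : E => y ^ Nat.card F * (x / x ^ Nat.card F) := by
        intro y
        simp only [mul_pow, div_pow, conj_conj]
        field_simp
      have hN : ∀ y : E, Algebra.norm F (y ^ Nat.card F * (x / x ^ Nat.card F)) =
          Algebra.norm F y := by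
        intro y
        apply (algebraMap F E).injective
        simp only [algebraMap_norm, mul_pow, div_pow, conj_conj]
        field_simp
      have hP : ∀ y : E, pairing (F := F) x (y ^ Nat.card F * (x / x ^ Nat.card F)) =
          pairing x y := by
        intro y
        apply (algebraMap F E).injective
        simp only [algebraMap_pairing, mul_pow, div_pow, conj_conj]
        field_simp
        ring
      have hF : ∀ y : E, f (y ^ Nat.card F * (x / x ^ Nat.card F)) = -f y := by
        intro y
        by_cases hy : HasSign s (Algebra.norm F y)
        · have hy0 : y ≠ 0 := by
            rintro rfl
            exact hy.1 (Algebra.norm_zero ..)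
          have hyc : y ^ Nat.card F ≠ 0 := pow_ne_zero _ hy0
          let z : Eˣ := Units.mk0 (x * y ^ Nat.card F) (mul_ne_zero hx0 hyc)
          have hNx : Algebra.norm F x ≠ 0 := by rwa [Ne, Algebra.norm_eq_zero_iff]
          have hNz : Algebra.norm F (z : E) = Algebra.norm F x * Algebra.norm F y := by
            apply (algebraMap F E).injective
            simp only [z, Units.val_mk0, map_mul, algebraMap_norm, conj_conj]
            ring
          have hz : ¬ IsSquare (Algebra.norm F (z : E)) := by
            rw [hNz]
            intro h
            apply hx
            refine ⟨hNx, ?_⟩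
            rw [← hy.2]
            exact ⟨fun h' => isSquare_of_mul hNx h' h,
              fun h' => isSquare_of_mul hy.1 h' (by rwa [mul_comm])⟩
          have hd : y ^ Nat.card F * x / (x ^ Nat.card F * y) ≠ 0 :=
            div_ne_zero (mul_ne_zero hyc hx0) (mul_ne_zero hxc hy0)
          let t : normKer F E := ⟨Units.mk0 _ hd, by
            rw [MonoidHom.mem_ker]
            ext
            change Algebra.norm F (y ^ Nat.card F * x / (x ^ Nat.card F * y)) = 1
            apply (algebraMap F E).injective
            simp only [algebraMap_norm, mul_pow, div_pow, conj_conj, map_one]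
            field_simp⟩
          have ht : ω t = -1 := by
            refine quadratic_apply h2 hω hω2 hz ?_
            change y ^ Nat.card F * x / (x ^ Nat.card F * y) *
              (x * y ^ Nat.card F) ^ Nat.card F = x * y ^ Nat.card F
            simp only [mul_pow, conj_conj]
            field_simp
          have := hf t y
          rw [ht] at this
          rw [show y ^ Nat.card F * (x / x ^ Nat.card F) = ((t : Eˣ) : E) * y by
            change _ = y ^ Nat.card F * x / (x ^ Nat.card F * y) * y
            field_simp, this]
          simp
        · rw [hs y hy, hs _ (by rwa [hN]), neg_zero]
      have key : ∑ y : E, ψ ((g 0 0 * Algebra.norm F x - pairing x y +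
            g 1 1 * Algebra.norm F y) / g 1 0) * f y =
          ∑ y : E, -(ψ ((g 0 0 * Algebra.norm F x - pairing x y +
            g 1 1 * Algebra.norm F y) / g 1 0) * f y) := by
        symm
        refine Fintype.sum_equiv hinv.toPerm _ _ fun y => ?_
        simp only [Function.Involutive.coe_toPerm, hN, hP, hF, mul_neg]
      rw [Finset.sum_neg_distrib] at key
      linear_combination key / 2

/-- For the character `ω₀` of order two of the kernel of the norm, `σ(ω₀)` is the direct sum of two
inequivalent cuspidal representations of degree `(|F| - 1) / 2`. They are labelled by signs:
`σ₀^s` consists of the functions supported on the elements whose norm has quadratic residue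
symbol `s`, so that the trace of the unipotent matrix with upper right entry `b ≠ 0` is
`∑ ψ (b y)`, with `y` running over the nonzero squares for `s = 1` and over the nonsquares for
`s = -1`. -/
def sigmaHalf (ψ : AddChar F ℂ) (hψ : ψ ≠ 1) (h2 : ringChar F ≠ 2) (ω₀ : normKer F E →* ℂˣ)
    (hω : ω₀ ≠ 1) (hω2 : ω₀ ^ 2 = 1) (s : ℤˣ) :
    Subrepresentation (weilRep (E := E) ψ hψ) where
  toSubmodule := (sigma ψ hψ ω₀).toSubmodule ⊓
    { carrier := {f : WeilSpace E | ∀ x : E, ¬ HasSign s (Algebra.norm F x) → f x = 0}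
      add_mem' := fun {f₁ f₂} h₁ h₂ x hx => by
        simp only [WeilSpace.add_apply, h₁ x hx, h₂ x hx, add_zero]
      zero_mem' := fun _ _ => rfl
      smul_mem' := fun c f h x hx => by
        simp only [WeilSpace.smul_apply, h x hx, mul_zero] }
  apply_mem_toSubmodule g f hf :=
    ⟨(sigma ψ hψ ω₀).apply_mem_toSubmodule g hf.1,
      fun x hx => sum_support h2 hω hω2 s g hf.1 hf.2 x hx⟩

end Finite

section Induction

/-- The one-dimensional representation attached to a character. -/
def charRep {H : Type*} [Group H] (χ : H →* ℂˣ) : Representation ℂ H ℂ :=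
  (Algebra.lmul ℂ ℂ).toRingHom.toMonoidHom.comp ((Units.coeHom ℂ).comp χ)

lemma charRep_apply {H : Type*} [Group H] (χ : H →* ℂˣ) (h : H) (z : ℂ) :
    charRep χ h z = χ h * z := rfl

/-- The twist of a representation by a character. -/
def twist {H V : Type*} [Group H] [AddCommGroup V] [Module ℂ V] (χ : H →* ℂˣ)
    (ρ : Representation ℂ H V) : Representation ℂ H V where
  toFun h := (χ h : ℂ) • ρ h
  map_one' := by simp
  map_mul' g h := by
    ext v
    simp [mul_smul, smul_comm (χ h : ℂ)]

/-- The space of the induced representation: the functions `f : G → V` with `f (h g) = ρ h (f g)`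
for all `h` in the subgroup `H`. -/
def IndSpace {G V : Type*} [Group G] [AddCommGroup V] [Module ℂ V] (H : Subgroup G)
    (ρ : Representation ℂ H V) : Submodule ℂ (G → V) :=
  Representation.coindV H.subtype ρ

/-- The representation of `G` induced from a representation `ρ` of the subgroup `H`: the right
translation action on `IndSpace H ρ`. If `H` is open in a profinite group `G` and `ρ` is smooth, every
function in `IndSpace H ρ` is locally constant, so that this is the smooth induction. -/
def Ind {G V : Type*} [Group G] [AddCommGroup V] [Module ℂ V] (H : Subgroup G)
    (ρ : Representation ℂ H V) : Representation ℂ G (IndSpace H ρ) :=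
  Representation.coind H.subtype ρ

variable {G A : Type*} [Group G] [CommGroup A]

/-- The product `H J` of two subgroups, the first of which normalizes the second. -/
def mulSubgroup (H J : Subgroup G) (hn : ∀ h ∈ H, ∀ j ∈ J, h * j * h⁻¹ ∈ J) : Subgroup G where
  carrier := {g | ∃ h ∈ H, ∃ j ∈ J, h * j = g}
  one_mem' := ⟨1, H.one_mem, 1, J.one_mem, mul_one 1⟩
  mul_mem' := by
    rintro _ _ ⟨h, hh, j, hj, rfl⟩ ⟨h', hh', j', hj', rfl⟩
    refine ⟨h * h', H.mul_mem hh hh', (h'⁻¹ * j * h') * j', J.mul_mem ?_ hj', by group⟩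
    simpa using hn h'⁻¹ (H.inv_mem hh') j hj
  inv_mem' := by
    rintro _ ⟨h, hh, j, hj, rfl⟩
    exact ⟨h⁻¹, H.inv_mem hh, h * j⁻¹ * h⁻¹, hn h hh _ (J.inv_mem hj), by group⟩

lemma glue_aux {H J : Subgroup G} {θ : H →* A} {φ : J →* A}
    (hc : ∀ (g : G) (hH : g ∈ H) (hJ : g ∈ J), θ ⟨g, hH⟩ = φ ⟨g, hJ⟩)
    {h h' j j' : G} (hh : h ∈ H) (hh' : h' ∈ H) (hj : j ∈ J) (hj' : j' ∈ J)
    (e : h * j = h' * j') : θ ⟨h, hh⟩ * φ ⟨j, hj⟩ = θ ⟨h', hh'⟩ * φ ⟨j', hj'⟩ := by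
  have e' : h'⁻¹ * h = j' * j⁻¹ := by
    rw [inv_mul_eq_iff_eq_mul, ← mul_assoc, ← e, mul_inv_cancel_right]
  have h1 : h'⁻¹ * h ∈ H := H.mul_mem (H.inv_mem hh') hh
  have h2 : h'⁻¹ * h ∈ J := by
    rw [e']
    exact J.mul_mem hj' (J.inv_mem hj)
  have := hc _ h1 h2
  have e1 : (⟨h'⁻¹ * h, h1⟩ : H) = ⟨h', hh'⟩⁻¹ * ⟨h, hh⟩ := rfl
  have e2 : (⟨h'⁻¹ * h, h2⟩ : J) = ⟨j', hj'⟩ * ⟨j, hj⟩⁻¹ := Subtype.ext e'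
  rw [e1, e2, map_mul, map_mul, map_inv, map_inv, inv_mul_eq_iff_eq_mul, ← mul_assoc,
    eq_mul_inv_iff_mul_eq] at this
  exact this

/-- The character of `H J` extending two characters `θ` of `H` and `φ` of `J` which agree on
`H ∩ J`, the second of which is invariant under conjugation by `H`. -/
def glue (H J : Subgroup G) (hn : ∀ h ∈ H, ∀ j ∈ J, h * j * h⁻¹ ∈ J) (θ : H →* A) (φ : J →* A)
    (hc : ∀ (g : G) (hH : g ∈ H) (hJ : g ∈ J), θ ⟨g, hH⟩ = φ ⟨g, hJ⟩)
    (hinv : ∀ (h : G) (hh : h ∈ H) (j : G) (hj : j ∈ J),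
      φ ⟨h * j * h⁻¹, hn h hh j hj⟩ = φ ⟨j, hj⟩) : mulSubgroup H J hn →* A :=
  MonoidHom.mk' (fun g => θ ⟨g.2.choose, g.2.choose_spec.1⟩ *
      φ ⟨g.2.choose_spec.2.choose, g.2.choose_spec.2.choose_spec.1⟩) (by
    have key : ∀ (g : mulSubgroup H J hn) (h : G) (hh : h ∈ H) (j : G) (hj : j ∈ J),
        h * j = g → θ ⟨g.2.choose, g.2.choose_spec.1⟩ *
          φ ⟨g.2.choose_spec.2.choose, g.2.choose_spec.2.choose_spec.1⟩ =
          θ ⟨h, hh⟩ * φ ⟨j, hj⟩ := fun g h hh j hj e =>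
      glue_aux hc _ _ _ _ (g.2.choose_spec.2.choose_spec.2.trans e.symm)
    rintro ⟨_, h, hh, j, hj, rfl⟩ ⟨_, h', hh', j', hj', rfl⟩
    have hm : h'⁻¹ * j * h' ∈ J := by simpa using hn h'⁻¹ (H.inv_mem hh') j hj
    rw [key _ (h * h') (H.mul_mem hh hh') ((h'⁻¹ * j * h') * j') (J.mul_mem hm hj')
      (by change _ = (h * j) * (h' * j'); group), key _ h hh j hj rfl, key _ h' hh' j' hj' rfl]
    have e1 : (⟨h * h', H.mul_mem hh hh'⟩ : H) = ⟨h, hh⟩ * ⟨h', hh'⟩ := rfl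
    have e2 : (⟨(h'⁻¹ * j * h') * j', J.mul_mem hm hj'⟩ : J) =
        ⟨h'⁻¹ * j * h', hm⟩ * ⟨j', hj'⟩ := rfl
    have e3 : φ ⟨h'⁻¹ * j * h', hm⟩ = φ ⟨j, hj⟩ := by
      rw [← hinv h'⁻¹ (H.inv_mem hh') j hj]
      congr 2
      simp
    rw [e1, e2, map_mul, map_mul, e3]
    exact mul_mul_mul_comm _ _ _ _)

lemma glue_apply {H J : Subgroup G} (hn : ∀ h ∈ H, ∀ j ∈ J, h * j * h⁻¹ ∈ J) (θ : H →* A)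
    (φ : J →* A) (hc : ∀ (g : G) (hH : g ∈ H) (hJ : g ∈ J), θ ⟨g, hH⟩ = φ ⟨g, hJ⟩)
    (hinv : ∀ (h : G) (hh : h ∈ H) (j : G) (hj : j ∈ J),
      φ ⟨h * j * h⁻¹, hn h hh j hj⟩ = φ ⟨j, hj⟩) (h : H) (j : J) :
    glue H J hn θ φ hc hinv ⟨h * j, h, h.2, j, j.2, rfl⟩ = θ h * φ j := by
  have g2 : ∃ h' ∈ H, ∃ j' ∈ J, h' * j' = (h * j : G) := ⟨h, h.2, j, j.2, rfl⟩
  exact glue_aux hc g2.choose_spec.1 h.2 g2.choose_spec.2.choose_spec.1 j.2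
    g2.choose_spec.2.choose_spec.2

end Induction

section Local

variable {k : Type*} [Field k] [ValuativeRel k] [TopologicalSpace k] [IsNonarchimedeanLocalField k]

/-- The inclusion of `SL₂(R)` into the matrix ring `M₂(k)`. -/
def toMat (g : SL(2, 𝒪[k])) : Matrix (Fin 2) (Fin 2) k := g.1.map (algebraMap 𝒪[k] k)

@[simp] lemma toMat_apply (g : SL(2, 𝒪[k])) (i j : Fin 2) : toMat g i j = (g i j : k) := rfl

@[simp] lemma toMat_mul (g h : SL(2, 𝒪[k])) : toMat (g * h) = toMat g * toMat h := by
  simp [toMat, Matrix.map_mul]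

@[simp] lemma toMat_one : toMat (1 : SL(2, 𝒪[k])) = 1 := by
  ext i j
  fin_cases i <;> fin_cases j <;> simp

/-- The antidiagonal matrix `X(u, v)`. -/
def antidiag (u v : k) : Matrix (Fin 2) (Fin 2) k := !![0, u; v, 0]

/-- The centralizer `T(X)` of the matrix `X` in `SL₂(R)`. -/
def centralizer (X : Matrix (Fin 2) (Fin 2) k) : Subgroup SL(2, 𝒪[k]) where
  carrier := {g | toMat g * X = X * toMat g}
  one_mem' := by simp
  mul_mem' := fun {g h} hg hh => by
    simp only [Set.mem_ofPred_eq, toMat_mul] at *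
    rw [mul_assoc, hh, ← mul_assoc, hg, mul_assoc]
  inv_mem' := fun {g} hg => by
    simp only [Set.mem_ofPred_eq] at *
    have h1 : toMat g⁻¹ * toMat g = 1 := by rw [← toMat_mul, inv_mul_cancel, toMat_one]
    have h2 : toMat g * toMat g⁻¹ = 1 := by rw [← toMat_mul, mul_inv_cancel, toMat_one]
    calc toMat g⁻¹ * X = toMat g⁻¹ * (X * toMat g) * toMat g⁻¹ := by
          rw [mul_assoc, mul_assoc, h2, mul_one]
      _ = X * toMat g⁻¹ := by rw [← hg, ← mul_assoc, h1, one_mul]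

lemma mul_00 (g h : SL(2, 𝒪[k])) : (g * h) 0 0 = g 0 0 * h 0 0 + g 0 1 * h 1 0 := by
  simp [Matrix.SpecialLinearGroup.coe_mul, Matrix.mul_apply, Fin.sum_univ_two]
lemma mul_01 (g h : SL(2, 𝒪[k])) : (g * h) 0 1 = g 0 0 * h 0 1 + g 0 1 * h 1 1 := by
  simp [Matrix.SpecialLinearGroup.coe_mul, Matrix.mul_apply, Fin.sum_univ_two]
lemma mul_10 (g h : SL(2, 𝒪[k])) : (g * h) 1 0 = g 1 0 * h 0 0 + g 1 1 * h 1 0 := by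
  simp [Matrix.SpecialLinearGroup.coe_mul, Matrix.mul_apply, Fin.sum_univ_two]
lemma mul_11 (g h : SL(2, 𝒪[k])) : (g * h) 1 1 = g 1 0 * h 0 1 + g 1 1 * h 1 1 := by
  simp [Matrix.SpecialLinearGroup.coe_mul, Matrix.mul_apply, Fin.sum_univ_two]
lemma inv_00 (g : SL(2, 𝒪[k])) : g⁻¹ 0 0 = g 1 1 := by
  rw [Matrix.SpecialLinearGroup.SL2_inv_expl]; rfl
lemma inv_01 (g : SL(2, 𝒪[k])) : g⁻¹ 0 1 = -g 0 1 := by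
  rw [Matrix.SpecialLinearGroup.SL2_inv_expl]; rfl
lemma inv_10 (g : SL(2, 𝒪[k])) : g⁻¹ 1 0 = -g 1 0 := by
  rw [Matrix.SpecialLinearGroup.SL2_inv_expl]; rfl
lemma inv_11 (g : SL(2, 𝒪[k])) : g⁻¹ 1 1 = g 0 0 := by
  rw [Matrix.SpecialLinearGroup.SL2_inv_expl]; rfl
lemma det_eq (g : SL(2, 𝒪[k])) : g 0 0 * g 1 1 - g 0 1 * g 1 0 = 1 := by
  rw [← Matrix.det_fin_two]
  exact g.2

variable (k) in
/-- The subgroup `G_{0,d/2} ∩ G_{1/2,d/2}` of `SL₂(R)`: the matrices of determinant one with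
diagonal entries in `1 + P^⌈d/2⌉`, upper right entry in `P^⌈d/2⌉` and lower left entry
in `P^⌈(d+1)/2⌉`. In natural numbers, `⌈d/2⌉ = (d + 1) / 2` and `⌈(d+1)/2⌉ = (d + 2) / 2`. -/
def levelGroup (d : ℕ) : Subgroup SL(2, 𝒪[k]) where
  carrier := {g | g 0 0 - 1 ∈ 𝓂[k] ^ ((d + 1) / 2) ∧ g 0 1 ∈ 𝓂[k] ^ ((d + 1) / 2) ∧
    g 1 0 ∈ 𝓂[k] ^ ((d + 2) / 2) ∧ g 1 1 - 1 ∈ 𝓂[k] ^ ((d + 1) / 2)}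
  one_mem' := by simp
  mul_mem' := by
    rintro g h ⟨g1, g2, g3, g4⟩ ⟨h1, h2, h3, h4⟩
    have hle : 𝓂[k] ^ ((d + 2) / 2) ≤ 𝓂[k] ^ ((d + 1) / 2) := Ideal.pow_le_pow_right (by omega)
    refine ⟨?_, ?_, ?_, ?_⟩
    · rw [mul_00, show g 0 0 * h 0 0 + g 0 1 * h 1 0 - 1 =
        g 0 0 * (h 0 0 - 1) + (g 0 0 - 1) + g 0 1 * h 1 0 by ring]
      exact add_mem (add_mem (Ideal.mul_mem_left _ _ h1) g1) (Ideal.mul_mem_right _ _ g2)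
    · rw [mul_01]
      exact add_mem (Ideal.mul_mem_left _ _ h2) (Ideal.mul_mem_right _ _ g2)
    · rw [mul_10]
      exact add_mem (Ideal.mul_mem_right _ _ g3) (Ideal.mul_mem_left _ _ h3)
    · rw [mul_11, show g 1 0 * h 0 1 + g 1 1 * h 1 1 - 1 =
        g 1 1 * (h 1 1 - 1) + (g 1 1 - 1) + g 1 0 * h 0 1 by ring]
      exact add_mem (add_mem (Ideal.mul_mem_left _ _ h4) g4) (Ideal.mul_mem_left _ _ h2)
  inv_mem' := by
    rintro g ⟨g1, g2, g3, g4⟩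
    refine ⟨?_, ?_, ?_, ?_⟩
    · rwa [inv_00]
    · rwa [inv_01, neg_mem_iff]
    · rwa [inv_10, neg_mem_iff]
    · rwa [inv_11]

/-- `Ψ` is trivial on the maximal ideal `P` but nontrivial on the ring of integers `R`. -/
def IsBasic (Ψ : AddChar k ℂ) : Prop :=
  (∀ x : 𝒪[k], x ∈ 𝓂[k] → Ψ (x : k) = 1) ∧ ∃ x : 𝒪[k], Ψ (x : k) ≠ 1

lemma IsBasic.eq {Ψ : AddChar k ℂ} (hΨ : IsBasic Ψ) {x y : 𝒪[k]}
    (h : IsLocalRing.residue 𝒪[k] x = IsLocalRing.residue 𝒪[k] y) : Ψ (x : k) = Ψ (y : k) := by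
  have h1 : x - y ∈ 𝓂[k] := by
    rwa [← IsLocalRing.residue_eq_zero_iff, map_sub, sub_eq_zero]
  have h2 := hΨ.1 _ h1
  have h3 : (x : k) = ((x - y : 𝒪[k]) : k) + y := by push_cast; ring
  rw [h3, AddChar.map_add_eq_mul, h2, one_mul]

/-- The additive character of the residue field whose inflation to `R` is the restriction
of `Ψ`. -/
def residueChar (Ψ : AddChar k ℂ) (hΨ : IsBasic Ψ) : AddChar 𝓀[k] ℂ where
  toFun a := Ψ (Function.surjInv (IsLocalRing.residue_surjective (R := 𝒪[k])) a : 𝒪[k])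
  map_zero_eq_one' := by
    rw [hΨ.eq (y := 0) ((Function.surjInv_eq _ _).trans (map_zero _).symm)]
    simp
  map_add_eq_mul' a b := by
    rw [← AddChar.map_add_eq_mul, ← Subring.coe_add]
    exact hΨ.eq (by rw [map_add]; simp only [Function.surjInv_eq])

lemma residueChar_residue (Ψ : AddChar k ℂ) (hΨ : IsBasic Ψ) (x : 𝒪[k]) :
    residueChar Ψ hΨ (IsLocalRing.residue 𝒪[k] x) = Ψ (x : k) :=
  hΨ.eq (Function.surjInv_eq _ _)

lemma residueChar_ne_one (Ψ : AddChar k ℂ) (hΨ : IsBasic Ψ) : residueChar Ψ hΨ ≠ 1 := by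
  obtain ⟨x, hx⟩ := hΨ.2
  intro h
  apply hx
  rw [← residueChar_residue Ψ hΨ, h, AddChar.one_apply]

/-! ### Valuations -/

lemma mem_max_iff (x : 𝒪[k]) : x ∈ 𝓂[k] ↔ valuation k (x : k) < 1 := by
  rw [IsLocalRing.mem_maximalIdeal, mem_nonunits_iff,
    (Valuation.integer.integers (valuation k)).isUnit_iff_valuation_eq_one]
  exact ⟨fun h => lt_of_le_of_ne x.2 h, fun h => h.ne⟩

lemma valuation_pow_le {ϖ : 𝒪[k]} (hϖ : Irreducible ϖ) {n : ℕ} {x : 𝒪[k]} (hx : x ∈ 𝓂[k] ^ n) :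
    valuation k (x : k) ≤ valuation k (ϖ : k) ^ n := by
  rw [hϖ.maximalIdeal_eq, Ideal.span_singleton_pow, Ideal.mem_span_singleton] at hx
  obtain ⟨y, rfl⟩ := hx
  push_cast
  rw [map_mul, map_pow]
  exact mul_le_of_le_one_right' y.2

lemma valuation_unif_lt {ϖ : 𝒪[k]} (hϖ : Irreducible ϖ) : valuation k (ϖ : k) < 1 := by
  rw [← mem_max_iff, hϖ.maximalIdeal_eq]
  exact Ideal.mem_span_singleton_self ϖ

lemma unif_ne {ϖ : 𝒪[k]} (hϖ : Irreducible ϖ) : (ϖ : k) ≠ 0 := by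
  intro h
  exact hϖ.ne_zero (Subtype.ext h)

variable {ϖ : 𝒪[k]} {d : ℕ} {u v : k}

/-- If `val v > val u = -d`, then `u P^(d+1)` and `v P^d` are contained in `P`. -/
lemma psi_entry {Ψ : AddChar k ℂ} (hΨ : IsBasic Ψ) (hϖ : Irreducible ϖ)
    (hu : valuation k u = valuation k (ϖ : k) ^ (-(d : ℤ))) (hv : valuation k v < valuation k u)
    {x y : 𝒪[k]} (hx : x ∈ 𝓂[k] ^ (d + 1)) (hy : y ∈ 𝓂[k] ^ d) : Ψ (u * x + v * y) = 1 := by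
  have h0 : valuation k (ϖ : k) ≠ 0 := by simpa using unif_ne hϖ
  have h1 : valuation k (u * x) < 1 := by
    rw [map_mul]
    calc valuation k u * valuation k (x : k) ≤
        valuation k u * valuation k (ϖ : k) ^ (d + 1) := by
          gcongr
          exact valuation_pow_le hϖ hx
      _ = valuation k (ϖ : k) := by
          rw [hu, zpow_neg, zpow_natCast, pow_succ, ← mul_assoc, inv_mul_cancel₀ (pow_ne_zero _ h0),
            one_mul]
      _ < 1 := valuation_unif_lt hϖ
  have h2 : valuation k (v * y) < 1 := by
    rw [map_mul]
    calc valuation k v * valuation k (y : k) ≤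
        valuation k v * valuation k (ϖ : k) ^ d := by
          gcongr
          exact valuation_pow_le hϖ hy
      _ < valuation k u * valuation k (ϖ : k) ^ d :=
          mul_lt_mul_of_pos_right hv (zero_lt_iff.2 (pow_ne_zero _ h0))
      _ = 1 := by
          rw [hu, zpow_neg, zpow_natCast, inv_mul_cancel₀ (pow_ne_zero _ h0)]
  have h3 : valuation k (u * x + v * y) < 1 := Valuation.map_add_lt _ h1 h2
  exact hΨ.1 ⟨u * x + v * y, h3.le⟩ ((mem_max_iff _).2 h3)

/-- The function `g ↦ Ψ(Tr(X (g - 1)))`. -/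
def psiFun (Ψ : AddChar k ℂ) (X : Matrix (Fin 2) (Fin 2) k) (g : SL(2, 𝒪[k])) : ℂ :=
  Ψ (X * (toMat g - 1)).trace

lemma psiFun_antidiag (Ψ : AddChar k ℂ) (u v : k) (g : SL(2, 𝒪[k])) :
    psiFun Ψ (antidiag u v) g = Ψ (u * (g 1 0 : 𝒪[k]) + v * (g 0 1 : 𝒪[k])) := by
  rw [psiFun, Matrix.trace_fin_two, Matrix.mul_apply, Matrix.mul_apply]
  simp [antidiag, Fin.sum_univ_two]

/-- For `X = X(u, v)` with `val v > val u = -d`, the character `Ψ_X : g ↦ Ψ(Tr(X (g - 1)))` of the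
group `levelGroup k d`. -/
def psiX (Ψ : AddChar k ℂ) (hΨ : IsBasic Ψ) (hϖ : Irreducible ϖ)
    (hu : valuation k u = valuation k (ϖ : k) ^ (-(d : ℤ))) (hv : valuation k v < valuation k u) :
    levelGroup k d →* ℂˣ :=
  MonoidHom.toHomUnits
    { toFun := fun g => psiFun Ψ (antidiag u v) g
      map_one' := by simp [psiFun]
      map_mul' := by
        rintro ⟨g, g1, g2, g3, g4⟩ ⟨h, h1, h2, h3, h4⟩
        change psiFun Ψ _ (g * h) = psiFun Ψ _ g * psiFun Ψ _ h
        rw [psiFun_antidiag, psiFun_antidiag, psiFun_antidiag, mul_10, mul_01]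
        have hx : g 1 0 * (h 0 0 - 1) + (g 1 1 - 1) * h 1 0 ∈ 𝓂[k] ^ (d + 1) := by
          rw [show d + 1 = (d + 2) / 2 + (d + 1) / 2 by omega, pow_add]
          refine add_mem (Ideal.mul_mem_mul g3 h1) ?_
          rw [mul_comm (g 1 1 - 1)]
          exact Ideal.mul_mem_mul h3 g4
        have hy : (g 0 0 - 1) * h 0 1 + g 0 1 * (h 1 1 - 1) ∈ 𝓂[k] ^ d := by
          have hle : 𝓂[k] ^ ((d + 1) / 2) * 𝓂[k] ^ ((d + 1) / 2) ≤ 𝓂[k] ^ d := by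
            rw [← pow_add]
            exact Ideal.pow_le_pow_right (by omega)
          exact add_mem (hle (Ideal.mul_mem_mul g1 h2)) (hle (Ideal.mul_mem_mul g2 h4))
        have key := psi_entry hΨ hϖ hu hv hx hy
        rw [← AddChar.map_add_eq_mul]
        rw [← one_mul (Ψ (_ + (_ + _))), ← key, ← AddChar.map_add_eq_mul]
        congr 1
        push_cast
        ring }

lemma psiX_apply (Ψ : AddChar k ℂ) (hΨ : IsBasic Ψ) (hϖ : Irreducible ϖ)
    (hu : valuation k u = valuation k (ϖ : k) ^ (-(d : ℤ))) (hv : valuation k v < valuation k u)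
    (g : levelGroup k d) : (psiX Ψ hΨ hϖ hu hv g : ℂ) = psiFun Ψ (antidiag u v) g := rfl

lemma mem_centralizer_antidiag {g : SL(2, 𝒪[k])} :
    g ∈ centralizer (antidiag u v) ↔ (g 0 1 : k) * v = u * (g 1 0 : 𝒪[k]) ∧
      (g 0 0 : k) * u = u * (g 1 1 : 𝒪[k]) ∧ (g 1 1 : k) * v = v * (g 0 0 : 𝒪[k]) := by
  change toMat g * antidiag u v = antidiag u v * toMat g ↔ _
  rw [← Matrix.ext_iff]
  simp [antidiag, Matrix.mul_apply, Fin.sum_univ_two, Fin.forall_fin_two]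
  constructor
  · rintro ⟨⟨h1, h2⟩, h3, -⟩
    exact ⟨h1, h2, h3⟩
  · rintro ⟨h1, h2, h3⟩
    exact ⟨⟨h1, h2⟩, h3, by rw [mul_comm, ← h1, mul_comm]⟩

lemma centralizer_lower (hv : valuation k v < valuation k u) {g : SL(2, 𝒪[k])}
    (hg : g ∈ centralizer (antidiag u v)) : g 1 0 ∈ 𝓂[k] := by
  have h1 := (mem_centralizer_antidiag.1 hg).1
  have hu0 : valuation k u ≠ 0 := (lt_of_le_of_lt zero_le hv).ne'
  rw [mem_max_iff]
  have h2 : valuation k (g 0 1 : k) * valuation k v =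
      valuation k u * valuation k (g 1 0 : k) := by
    rw [← map_mul, ← map_mul, h1]
  have h3 : valuation k u * valuation k (g 1 0 : k) < valuation k u * 1 := by
    rw [← h2, mul_one]
    exact lt_of_le_of_lt (mul_le_of_le_one_left' (g 0 1).2) hv
  exact lt_of_mul_lt_mul_left' h3

lemma levelGroup_conj {h : SL(2, 𝒪[k])} (hh : h 1 0 ∈ 𝓂[k]) {j : SL(2, 𝒪[k])} (hj : j ∈ levelGroup k d) :
    h * j * h⁻¹ ∈ levelGroup k d := by
  obtain ⟨j1, j2, j3, j4⟩ := hj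
  have hle : 𝓂[k] ^ ((d + 2) / 2) ≤ 𝓂[k] ^ ((d + 1) / 2) := Ideal.pow_le_pow_right (by omega)
  have hle2 : 𝓂[k] * 𝓂[k] ^ ((d + 1) / 2) ≤ 𝓂[k] ^ ((d + 2) / 2) := by
    rw [← pow_succ']
    exact Ideal.pow_le_pow_right (by omega)
  have hd := det_eq h
  have j3' := hle j3
  refine ⟨?_, ?_, ?_, ?_⟩
  · rw [mul_00, mul_00, mul_01, inv_00, inv_10,
      show (h 0 0 * j 0 0 + h 0 1 * j 1 0) * h 1 1 + (h 0 0 * j 0 1 + h 0 1 * j 1 1) * -h 1 0 - 1 =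
        (h 0 0 * h 1 1) * (j 0 0 - 1) + (h 0 1 * h 1 1) * j 1 0 - (h 0 0 * h 1 0) * j 0 1 -
          (h 0 1 * h 1 0) * (j 1 1 - 1) by linear_combination hd]
    exact sub_mem (sub_mem (add_mem (Ideal.mul_mem_left _ _ j1) (Ideal.mul_mem_left _ _ j3'))
      (Ideal.mul_mem_left _ _ j2)) (Ideal.mul_mem_left _ _ j4)
  · rw [mul_01, mul_00, mul_01, inv_01, inv_11,
      show (h 0 0 * j 0 0 + h 0 1 * j 1 0) * -h 0 1 + (h 0 0 * j 0 1 + h 0 1 * j 1 1) * h 0 0 =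
        -(h 0 0 * h 0 1) * (j 0 0 - 1) - (h 0 1 * h 0 1) * j 1 0 + (h 0 0 * h 0 0) * j 0 1 +
          (h 0 1 * h 0 0) * (j 1 1 - 1) by ring]
    exact add_mem (add_mem (sub_mem (Ideal.mul_mem_left _ _ j1) (Ideal.mul_mem_left _ _ j3'))
      (Ideal.mul_mem_left _ _ j2)) (Ideal.mul_mem_left _ _ j4)
  · rw [mul_10, mul_10, mul_11, inv_00, inv_10,
      show (h 1 0 * j 0 0 + h 1 1 * j 1 0) * h 1 1 + (h 1 0 * j 0 1 + h 1 1 * j 1 1) * -h 1 0 =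
        h 1 1 * (h 1 0 * (j 0 0 - 1)) + (h 1 1 * h 1 1) * j 1 0 - h 1 0 * (h 1 0 * j 0 1) -
          h 1 1 * (h 1 0 * (j 1 1 - 1)) by ring]
    exact sub_mem (sub_mem (add_mem (Ideal.mul_mem_left _ _ (hle2 (Ideal.mul_mem_mul hh j1)))
      (Ideal.mul_mem_left _ _ j3)) (Ideal.mul_mem_left _ _ (hle2 (Ideal.mul_mem_mul hh j2))))
      (Ideal.mul_mem_left _ _ (hle2 (Ideal.mul_mem_mul hh j4)))
  · rw [mul_11, mul_10, mul_11, inv_01, inv_11,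
      show (h 1 0 * j 0 0 + h 1 1 * j 1 0) * -h 0 1 + (h 1 0 * j 0 1 + h 1 1 * j 1 1) * h 0 0 - 1 =
        -(h 1 0 * h 0 1) * (j 0 0 - 1) - (h 1 1 * h 0 1) * j 1 0 + (h 1 0 * h 0 0) * j 0 1 +
          (h 1 1 * h 0 0) * (j 1 1 - 1) by linear_combination hd]
    exact add_mem (add_mem (sub_mem (Ideal.mul_mem_left _ _ j1) (Ideal.mul_mem_left _ _ j3'))
      (Ideal.mul_mem_left _ _ j2)) (Ideal.mul_mem_left _ _ j4)

lemma psiFun_conj (Ψ : AddChar k ℂ) {X : Matrix (Fin 2) (Fin 2) k} {h : SL(2, 𝒪[k])}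
    (hh : h ∈ centralizer X) (j : SL(2, 𝒪[k])) : psiFun Ψ X (h * j * h⁻¹) = psiFun Ψ X j := by
  have hX : toMat h * X = X * toMat h := hh
  have h1 : toMat h⁻¹ * toMat h = 1 := by rw [← toMat_mul, inv_mul_cancel, toMat_one]
  have h2 : toMat h * toMat h⁻¹ = 1 := by rw [← toMat_mul, mul_inv_cancel, toMat_one]
  have h3 : toMat (h * j * h⁻¹) - 1 = toMat h * (toMat j - 1) * toMat h⁻¹ := by
    rw [mul_sub, sub_mul, mul_one, h2, toMat_mul, toMat_mul]
  rw [psiFun, psiFun, h3, ← mul_assoc, ← mul_assoc, ← hX, Matrix.trace_mul_comm, ← mul_assoc,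
    ← mul_assoc, h1, one_mul]

/-- The group `T(X) J` with `X = X(u, v)` and `J = levelGroup k d`. -/
abbrev shalikaGroup (d : ℕ) (hv : valuation k v < valuation k u) : Subgroup SL(2, 𝒪[k]) :=
  mulSubgroup (centralizer (antidiag u v)) (levelGroup k d) fun _ hh _ hj =>
    levelGroup_conj (centralizer_lower hv hh) hj

/-- For a character `θ` of `T(X)` which coincides with `Ψ_X` on `T(X) ∩ J`, the character
`Ψ_{θ,X}` of `T(X) J` extending `θ` and `Ψ_X`. -/
def shalikaChar (Ψ : AddChar k ℂ) (hΨ : IsBasic Ψ) (hϖ : Irreducible ϖ)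
    (hu : valuation k u = valuation k (ϖ : k) ^ (-(d : ℤ))) (hv : valuation k v < valuation k u)
    (θ : centralizer (antidiag u v) →* ℂˣ)
    (hθ : ∀ g : centralizer (antidiag u v), (g : SL(2, 𝒪[k])) ∈ levelGroup k d →
      (θ g : ℂ) = psiFun Ψ (antidiag u v) g) : shalikaGroup d hv →* ℂˣ :=
  glue (centralizer (antidiag u v)) (levelGroup k d) _ θ (psiX Ψ hΨ hϖ hu hv)
    (fun g hT hJ => Units.ext (hθ ⟨g, hT⟩ hJ))
    (fun _ hh j _ => Units.ext (psiFun_conj Ψ hh j))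

lemma shalikaChar_apply (Ψ : AddChar k ℂ) (hΨ : IsBasic Ψ) (hϖ : Irreducible ϖ)
    (hu : valuation k u = valuation k (ϖ : k) ^ (-(d : ℤ))) (hv : valuation k v < valuation k u)
    (θ : centralizer (antidiag u v) →* ℂˣ)
    (hθ : ∀ g : centralizer (antidiag u v), (g : SL(2, 𝒪[k])) ∈ levelGroup k d →
      (θ g : ℂ) = psiFun Ψ (antidiag u v) g) (t : centralizer (antidiag u v)) (j : levelGroup k d) :
    (shalikaChar Ψ hΨ hϖ hu hv θ hθ ⟨t * j, t, t.2, j, j.2, rfl⟩ : ℂ) =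
      θ t * psiFun Ψ (antidiag u v) j := by
  have h := glue_apply (fun _ hh _ hj => levelGroup_conj (centralizer_lower hv hh) hj) θ
    (psiX Ψ hΨ hϖ hu hv) (fun g hT hJ => Units.ext (hθ ⟨g, hT⟩ hJ))
    (fun _ hh j _ => Units.ext (psiFun_conj Ψ hh j)) t j
  exact congrArg Units.val h

/-- Shalika's representation `S_d(θ, X)` of `SL₂(R)`, for `X = X(u, v)` with
`val v > val u = -d` and a character `θ` of `T(X)` which coincides with `Ψ_X` on `T(X) ∩ J`. -/
def shalikaRep (Ψ : AddChar k ℂ) (hΨ : IsBasic Ψ) (hϖ : Irreducible ϖ)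
    (hu : valuation k u = valuation k (ϖ : k) ^ (-(d : ℤ))) (hv : valuation k v < valuation k u)
    (θ : centralizer (antidiag u v) →* ℂˣ)
    (hθ : ∀ g : centralizer (antidiag u v), (g : SL(2, 𝒪[k])) ∈ levelGroup k d →
      (θ g : ℂ) = psiFun Ψ (antidiag u v) g) :
    Representation ℂ SL(2, 𝒪[k])
      (IndSpace (shalikaGroup d hv) (charRep (shalikaChar Ψ hΨ hϖ hu hv θ hθ))) :=
  Ind (shalikaGroup d hv) (charRep (shalikaChar Ψ hΨ hϖ hu hv θ hθ))

/-! ### The case `X = X(u, 0)` -/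

/-- The homomorphism from `T(X(u, 0)) = Z U`, where `U` is the group of upper triangular unipotent
matrices, to the center `Z` of `SL₂(R)`. It is the identity on `Z` and trivial on `U`. -/
def toCenter (hu0 : u ≠ 0) :
    centralizer (antidiag u 0) →* Subgroup.center SL(2, 𝒪[k]) := by
  have h10 : ∀ g : centralizer (antidiag u 0), (g : SL(2, 𝒪[k])) 1 0 = 0 := by
    intro g
    have := (mem_centralizer_antidiag.1 g.2).1
    rw [mul_zero, eq_comm, mul_eq_zero] at this
    exact Subtype.ext (this.resolve_left hu0)
  have h11 : ∀ g : centralizer (antidiag u 0),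
      (g : SL(2, 𝒪[k])) 0 0 = (g : SL(2, 𝒪[k])) 1 1 := by
    intro g
    have := (mem_centralizer_antidiag.1 g.2).2.1
    rw [mul_comm] at this
    exact Subtype.ext (mul_left_cancel₀ hu0 this)
  have hsq : ∀ g : centralizer (antidiag u 0),
      (g : SL(2, 𝒪[k])) 0 0 * (g : SL(2, 𝒪[k])) 0 0 = 1 := by
    intro g
    have := det_eq (g : SL(2, 𝒪[k]))
    rw [h10, ← h11] at this
    linear_combination this
  exact
  { toFun := fun g => ⟨⟨!![(g : SL(2, 𝒪[k])) 0 0, 0; 0, (g : SL(2, 𝒪[k])) 0 0], by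
        rw [Matrix.det_fin_two_of, hsq]
        simp⟩, by
      refine Matrix.SpecialLinearGroup.mem_center_iff.2 ⟨(g : SL(2, 𝒪[k])) 0 0, ?_, ?_⟩
      · rw [Fintype.card_fin, sq, hsq]
      · ext i j
        fin_cases i <;> fin_cases j <;> simp⟩
    map_one' := by
      apply Subtype.ext
      apply Subtype.ext
      ext i j
      fin_cases i <;> fin_cases j <;> simp
    map_mul' := fun g h => by
      apply Subtype.ext
      apply Subtype.ext
      change !![((g : SL(2, 𝒪[k])) * (h : SL(2, 𝒪[k]))) 0 0, 0; 0,
        ((g : SL(2, 𝒪[k])) * (h : SL(2, 𝒪[k]))) 0 0] = !![(g : SL(2, 𝒪[k])) 0 0, 0; 0,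
        (g : SL(2, 𝒪[k])) 0 0] * !![(h : SL(2, 𝒪[k])) 0 0, 0; 0, (h : SL(2, 𝒪[k])) 0 0]
      rw [mul_00, h10 h, Matrix.mul_fin_two]
      simp }

lemma toCenter_apply (hu0 : u ≠ 0) (g : centralizer (antidiag u 0)) :
    ((toCenter hu0 g : SL(2, 𝒪[k])) : Matrix (Fin 2) (Fin 2) 𝒪[k]) =
      !![(g : SL(2, 𝒪[k])) 0 0, 0; 0, (g : SL(2, 𝒪[k])) 0 0] := rfl

lemma centralizer_level (hp : ringChar 𝓀[k] ≠ 2) (hd : 0 < d) (hu0 : u ≠ 0)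
    (g : centralizer (antidiag u 0)) (hg : (g : SL(2, 𝒪[k])) ∈ levelGroup k d) :
    (g : SL(2, 𝒪[k])) 0 0 = 1 ∧ (g : SL(2, 𝒪[k])) 1 0 = 0 := by
  have h := mem_centralizer_antidiag.1 g.2
  have h10 : (g : SL(2, 𝒪[k])) 1 0 = 0 := by
    have := h.1
    rw [mul_zero, eq_comm, mul_eq_zero] at this
    exact Subtype.ext (this.resolve_left hu0)
  have h11 : (g : SL(2, 𝒪[k])) 0 0 = (g : SL(2, 𝒪[k])) 1 1 := by
    have := h.2.1
    rw [mul_comm] at this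
    exact Subtype.ext (mul_left_cancel₀ hu0 this)
  have hdet := det_eq (g : SL(2, 𝒪[k]))
  rw [h10, ← h11] at hdet
  have hm : (g : SL(2, 𝒪[k])) 0 0 - 1 ∈ 𝓂[k] :=
    Ideal.pow_le_self (by omega) hg.1
  refine ⟨?_, h10⟩
  have hne : (g : SL(2, 𝒪[k])) 0 0 + 1 ≠ 0 := by
    intro h0
    have h2 : (2 : 𝒪[k]) ∈ 𝓂[k] := by
      have := neg_mem hm
      rwa [show -((g : SL(2, 𝒪[k])) 0 0 - 1) = 2 by linear_combination -h0] at this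
    rw [← IsLocalRing.residue_eq_zero_iff, map_ofNat] at h2
    exact Ring.two_ne_zero hp h2
  have : ((g : SL(2, 𝒪[k])) 0 0 - 1) * ((g : SL(2, 𝒪[k])) 0 0 + 1) = 0 := by
    linear_combination hdet
  exact sub_eq_zero.1 ((mul_eq_zero.1 this).resolve_right hne)

/-- The trivial extension to `T(X(u, 0)) = Z U` of a character of `Z` agrees with `Ψ_X` on
`T(X) ∩ J`: both are trivial there. -/
lemma theta_compat (hp : ringChar 𝓀[k] ≠ 2) (hd : 0 < d) (Ψ : AddChar k ℂ) (hu0 : u ≠ 0)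
    (θ : Subgroup.center SL(2, 𝒪[k]) →* ℂˣ)
    (g : centralizer (antidiag u 0)) (hg : (g : SL(2, 𝒪[k])) ∈ levelGroup k d) :
    (θ.comp (toCenter hu0) g : ℂ) = psiFun Ψ (antidiag u 0) g := by
  obtain ⟨h00, h10⟩ := centralizer_level hp hd hu0 g hg
  have h1 : toCenter hu0 g = 1 := by
    apply Subtype.ext
    apply Subtype.ext
    rw [toCenter_apply, h00]
    ext i j
    fin_cases i <;> fin_cases j <;> simp
  rw [psiFun_antidiag, h10, MonoidHom.comp_apply, h1]
  simp

/-- For a unit `a`, the element `a ϖ^(-d)` of `k`. -/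
abbrev unifPow (ϖ : 𝒪[k]) (d : ℕ) (a : 𝒪[k]ˣ) : k := ((a : 𝒪[k]) : k) * (ϖ : k) ^ (-(d : ℤ))

lemma unifPow_ne (hϖ : Irreducible ϖ) (a : 𝒪[k]ˣ) : unifPow ϖ d a ≠ 0 := by
  refine mul_ne_zero ?_ (zpow_ne_zero _ (unif_ne hϖ))
  intro h
  exact a.ne_zero (Subtype.ext h)

lemma valuation_unifPow (a : 𝒪[k]ˣ) :
    valuation k (unifPow ϖ d a) = valuation k (ϖ : k) ^ (-(d : ℤ)) := by
  rw [unifPow, map_mul, map_zpow₀]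
  have := (Valuation.integer.integers (valuation k)).isUnit_iff_valuation_eq_one.1 a.isUnit
  change valuation k ((a : 𝒪[k]) : k) = 1 at this
  rw [this, one_mul]

lemma valuation_zero_lt (hϖ : Irreducible ϖ) (a : 𝒪[k]ˣ) :
    valuation k (0 : k) < valuation k (unifPow ϖ d a) := by
  rw [map_zero, zero_lt_iff]
  simpa using unifPow_ne hϖ a

/-- The representation `S_d(θ, X(a ϖ^(-d), 0))`, for a unit `a` and a character `θ` of the center
of `SL₂(R)`, extended trivially over `U` to a character of `T(X(a ϖ^(-d), 0)) = Z U`. -/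
abbrev shalikaNilp (hp : ringChar 𝓀[k] ≠ 2) (Ψ : AddChar k ℂ) (hΨ : IsBasic Ψ)
    (hϖ : Irreducible ϖ) (hd : 0 < d) (θ : Subgroup.center SL(2, 𝒪[k]) →* ℂˣ) (a : 𝒪[k]ˣ) :=
  shalikaRep Ψ hΨ hϖ (valuation_unifPow (d := d) a) (valuation_zero_lt hϖ a)
    (θ.comp (toCenter (unifPow_ne hϖ a)))
    (theta_compat hp hd Ψ (unifPow_ne hϖ a) θ)

/-! ### The representations `π_d^±(θ)` -/

variable (k) in
/-- The group `B K_d` of the elements of `SL₂(R)` whose lower left entry lies in `P^d`. -/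
def bK (d : ℕ) : Subgroup SL(2, 𝒪[k]) where
  carrier := {g | g 1 0 ∈ 𝓂[k] ^ d}
  one_mem' := by simp
  mul_mem' := fun {g h} hg hh => by
    change (g * h) 1 0 ∈ 𝓂[k] ^ d
    rw [mul_10]
    exact add_mem (Ideal.mul_mem_right _ _ hg) (Ideal.mul_mem_left _ _ hh)
  inv_mem' := fun {g} hg => by
    change (g⁻¹ : SL(2, 𝒪[k])) 1 0 ∈ 𝓂[k] ^ d
    rw [inv_10]
    exact neg_mem hg

lemma bK_dvd (hϖ : Irreducible ϖ) (g : bK k d) : ϖ ^ d ∣ (g : SL(2, 𝒪[k])) 1 0 := by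
  have h : (g : SL(2, 𝒪[k])) 1 0 ∈ 𝓂[k] ^ d := g.2
  rwa [hϖ.maximalIdeal_eq, Ideal.span_singleton_pow, Ideal.mem_span_singleton] at h

/-- The matrix `η = diag(1, ϖ)`. -/
def eta (ϖ : 𝒪[k]) : Matrix (Fin 2) (Fin 2) k := !![1, 0; 0, (ϖ : k)]

lemma eta_inv_mul (hϖ : Irreducible ϖ) : (eta ϖ)⁻¹ * eta ϖ = 1 := by
  refine Matrix.nonsing_inv_mul _ ?_
  rw [eta, Matrix.det_fin_two_of]
  simpa using unif_ne hϖ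

lemma eta_pow (ϖ : 𝒪[k]) (d : ℕ) : eta ϖ ^ d = !![1, 0; 0, (ϖ : k) ^ d] := by
  induction d with
  | zero => simp [Matrix.one_fin_two]
  | succ n ih => rw [pow_succ, ih, eta, Matrix.mul_fin_two]; simp [pow_succ]

lemma eta_inv_pow_mul (hϖ : Irreducible ϖ) (d : ℕ) : (eta ϖ)⁻¹ ^ d * eta ϖ ^ d = 1 := by
  have h1 := eta_inv_mul hϖ
  have h2 : eta ϖ * (eta ϖ)⁻¹ = 1 := mul_eq_one_comm.1 h1
  have hc : Commute (eta ϖ)⁻¹ (eta ϖ) := h1.trans h2.symm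
  rw [← hc.mul_pow, h1, one_pow]

/-- The matrix `η^(-d) g η^d`, for `g` in `B K_d`, as an element of `SL₂(R)`. -/
def etaConjFun (hϖ : Irreducible ϖ) (g : bK k d) : SL(2, 𝒪[k]) :=
  ⟨!![(g : SL(2, 𝒪[k])) 0 0, ϖ ^ d * (g : SL(2, 𝒪[k])) 0 1;
    (bK_dvd hϖ g).choose, (g : SL(2, 𝒪[k])) 1 1], by
    have h := det_eq (g : SL(2, 𝒪[k]))
    rw [(bK_dvd hϖ g).choose_spec] at h
    rw [Matrix.det_fin_two_of]
    linear_combination h⟩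

lemma etaConjFun_spec (hϖ : Irreducible ϖ) (g : bK k d) :
    toMat (etaConjFun hϖ g) = (eta ϖ)⁻¹ ^ d * toMat (g : SL(2, 𝒪[k])) * eta ϖ ^ d := by
  have h : eta ϖ ^ d * toMat (etaConjFun hϖ g) = toMat (g : SL(2, 𝒪[k])) * eta ϖ ^ d := by
    have hc := congrArg (algebraMap 𝒪[k] k) (bK_dvd hϖ g).choose_spec
    rw [map_mul, map_pow] at hc
    have h00 : toMat (etaConjFun hϖ g) 0 0 = ((g : SL(2, 𝒪[k])) 0 0 : k) := rfl
    have h01 : toMat (etaConjFun hϖ g) 0 1 = (ϖ : k) ^ d * ((g : SL(2, 𝒪[k])) 0 1 : k) := rfl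
    have h10 : toMat (etaConjFun hϖ g) 1 0 = ((bK_dvd hϖ g).choose : k) := rfl
    have h11 : toMat (etaConjFun hϖ g) 1 1 = ((g : SL(2, 𝒪[k])) 1 1 : k) := rfl
    change ((g : SL(2, 𝒪[k])) 1 0 : k) = (ϖ : k) ^ d * ((bK_dvd hϖ g).choose : k) at hc
    rw [eta_pow, Matrix.eta_fin_two (toMat (etaConjFun hϖ g)), h00, h01, h10, h11,
      Matrix.eta_fin_two (toMat (g : SL(2, 𝒪[k]))), Matrix.mul_fin_two, Matrix.mul_fin_two]
    ext i j
    fin_cases i <;> fin_cases j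
    · simp
    · simp [mul_comm]
    · simpa using hc.symm
    · simp [mul_comm]
  rw [mul_assoc, ← h, ← mul_assoc, eta_inv_pow_mul hϖ, one_mul]

lemma toMat_injective : Function.Injective (toMat (k := k)) := by
  intro g h e
  ext i j
  have := congrFun (congrFun e i) j
  simpa using this

/-- The homomorphism `g ↦ η^(-d) g η^d` from `B K_d` to `SL₂(R)`. -/
def etaConj (hϖ : Irreducible ϖ) (d : ℕ) : bK k d →* SL(2, 𝒪[k]) :=
  MonoidHom.mk' (etaConjFun hϖ) fun g h => by
    have h2 : eta ϖ ^ d * (eta ϖ)⁻¹ ^ d = 1 := mul_eq_one_comm.1 (eta_inv_pow_mul hϖ d)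
    apply toMat_injective
    rw [toMat_mul, etaConjFun_spec, etaConjFun_spec, etaConjFun_spec, Subgroup.coe_mul, toMat_mul]
    calc (eta ϖ)⁻¹ ^ d * (toMat (g : SL(2, 𝒪[k])) * toMat (h : SL(2, 𝒪[k]))) * eta ϖ ^ d =
        (eta ϖ)⁻¹ ^ d * toMat (g : SL(2, 𝒪[k])) * 1 * toMat (h : SL(2, 𝒪[k])) * eta ϖ ^ d := by
          simp only [mul_assoc, one_mul]
      _ = _ := by
          rw [← h2]
          simp only [mul_assoc]

/-- Reduction modulo the maximal ideal. -/
def reduction : SL(2, 𝒪[k]) →* SL(2, 𝓀[k]) :=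
  Matrix.SpecialLinearGroup.map (IsLocalRing.residue 𝒪[k])

/-- The extension to `B K_d` of a character `τ` of the diagonal torus which factors through the
residue field: `g ↦ τ (g₁₁ mod P)`. -/
def tauExt (hd : 0 < d) (τ : 𝓀[k]ˣ →* ℂˣ) : bK k d →* ℂˣ := by
  have h10 : ∀ g : bK k d, reduction (g : SL(2, 𝒪[k])) 1 0 = 0 := fun g =>
    (IsLocalRing.residue_eq_zero_iff _).2 (Ideal.pow_le_self hd.ne' g.2)
  exact τ.comp (MonoidHom.toHomUnits
    { toFun := fun g => reduction (g : SL(2, 𝒪[k])) 0 0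
      map_one' := by simp
      map_mul' := fun g h => by
        rw [Subgroup.coe_mul, map_mul, Matrix.SpecialLinearGroup.coe_mul, Matrix.mul_apply,
          Fin.sum_univ_two, h10 h, mul_zero, add_zero] })

variable {κ' : Type*} [Field κ'] [Fintype κ'] [Algebra 𝓀[k] κ']
  [Algebra.IsQuadraticExtension 𝓀[k] κ']

/-- The character `θ` of the center of `SL₂(R)` coincides with the central character of
`σ₀ = σ(ω₀)`, inflated to `SL₂(R)`. -/
def IsCentralChar (Ψ : AddChar k ℂ) (hΨ : IsBasic Ψ) (ω₀ : normKer 𝓀[k] κ' →* ℂˣ)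
    (θ : Subgroup.center SL(2, 𝒪[k]) →* ℂˣ) : Prop :=
  ∀ z : Subgroup.center SL(2, 𝒪[k]),
    (sigma (residueChar Ψ hΨ) (residueChar_ne_one Ψ hΨ) ω₀).toRepresentation
      (reduction (z : SL(2, 𝒪[k]))) = (θ z : ℂ) • LinearMap.id

open Classical in
/-- The representation of `B K_d` which induces `π_d^s(θ)`: the conjugate `(σ₀^s)^(η^d)`, whose
value at `g` is `σ₀^s(η^(-d) g η^d)`, twisted by `τ` if `θ` is not the central character
of `σ₀`. -/
def piInducing (hp : ringChar 𝓀[k] ≠ 2) (Ψ : AddChar k ℂ) (hΨ : IsBasic Ψ) (hϖ : Irreducible ϖ)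
    (ω₀ : normKer 𝓀[k] κ' →* ℂˣ) (hω : ω₀ ≠ 1) (hω2 : ω₀ ^ 2 = 1) (τ : 𝓀[k]ˣ →* ℂˣ)
    (hd : 0 < d) (θ : Subgroup.center SL(2, 𝒪[k]) →* ℂˣ) (s : ℤˣ) :
    Representation ℂ (bK k d) (sigmaHalf (E := κ') (residueChar Ψ hΨ) (residueChar_ne_one Ψ hΨ) hp ω₀
      hω hω2 s).toSubmodule :=
  twist (if IsCentralChar Ψ hΨ ω₀ θ then 1 else tauExt hd τ)
    ((sigmaHalf (residueChar Ψ hΨ) (residueChar_ne_one Ψ hΨ) hp ω₀ hω hω2 s).toRepresentation.comp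
      (reduction.comp (etaConj hϖ d)))

/-- The representation `π_d^+(θ)` of `SL₂(R)`. -/
def piPlus (hp : ringChar 𝓀[k] ≠ 2) (Ψ : AddChar k ℂ) (hΨ : IsBasic Ψ) (hϖ : Irreducible ϖ)
    (ω₀ : normKer 𝓀[k] κ' →* ℂˣ) (hω : ω₀ ≠ 1) (hω2 : ω₀ ^ 2 = 1) (τ : 𝓀[k]ˣ →* ℂˣ)
    (hd : 0 < d) (θ : Subgroup.center SL(2, 𝒪[k]) →* ℂˣ) :
    Representation ℂ SL(2, 𝒪[k])
      (IndSpace (bK k d) (piInducing hp Ψ hΨ hϖ ω₀ hω hω2 τ hd θ 1)) :=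
  Ind (bK k d) (piInducing hp Ψ hΨ hϖ ω₀ hω hω2 τ hd θ 1)

/-- The representation `π_d^-(θ)` of `SL₂(R)`. -/
def piMinus (hp : ringChar 𝓀[k] ≠ 2) (Ψ : AddChar k ℂ) (hΨ : IsBasic Ψ) (hϖ : Irreducible ϖ)
    (ω₀ : normKer 𝓀[k] κ' →* ℂˣ) (hω : ω₀ ≠ 1) (hω2 : ω₀ ^ 2 = 1) (τ : 𝓀[k]ˣ →* ℂˣ)
    (hd : 0 < d) (θ : Subgroup.center SL(2, 𝒪[k]) →* ℂˣ) :
    Representation ℂ SL(2, 𝒪[k])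
      (IndSpace (bK k d) (piInducing hp Ψ hΨ hϖ ω₀ hω hω2 τ hd θ (-1))) :=
  Ind (bK k d) (piInducing hp Ψ hΨ hϖ ω₀ hω hω2 τ hd θ (-1))

end Local
end

end DepthZero

open DepthZero

namespace DepthZero

noncomputable section

/-! ### Induced representations: irreducibility and intertwining operators. -/

section Mackey

variable {G : Type*} [Group G]

/-! Conjugation by η^(-d) multiplies the upper right entry of an element of B_d by ϖ^d and divides
the lower left entry by ϖ^d. Modulo P the result is lower triangular, so π_d^±(θ) depends only on
the restriction of σ₀^± to the lower triangular matrices over κ. There a Whittaker-type functional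
is at hand: apply the Weyl element and evaluate at a point x₀ of κ' whose norm a has the sign
defining σ₀^±. Lower unipotents multiply it by ψ(-c a), where c is their lower left entry, and the
diagonal torus moves x₀ through κˣ x₀ (`weylFunctional_lower`). In terms of g in B_d, the functional
transforms under H = {g₂₁ ∈ P^d, g₁₁ ∈ ±1 + P} by a character χ, equal to Ψ(-a ϖ^(-d) g₂₁) when g₁₁
∈ 1 + P. The twist by τ is present exactly when it is needed to make χ(-1) = θ(-1).

On the other side, T(X)J for X = X(-a ϖ^(-d), 0) is the group S = {g₂₁ ∈ P^⌈(d+1)/2⌉, g₁₁ ∈ ±1 +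
P^⌈d/2⌉}, and its character μ is given by the same formula near the identity and by the same value
θ(-1) at -1. Hence χ and μ agree on H ∩ S (`eq_of_formula`).

Both pairs are of one type: g₂₁ ∈ P^m and g₁₁ ∈ ±1 + P^n with m + n = d + 1, where (m, n) is (d, 1)
for H and (⌈(d+1)/2⌉, ⌈d/2⌉) for S. One Mackey computation, `ind_isIrreducible_of_level`, shows that
both induced representations are irreducible. Schur's lemma then replaces all dimension counts.
Averaging over S/(H ∩ S) is a nonzero intertwining map Ind χ → Ind μ, hence an isomorphism
(`ind_equiv_of_agree`). Composition with the functional is an intertwining map from π_d^±(θ) to Ind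
χ, injective because the B_d-translates of the functional separate points, and surjective because
Ind χ is irreducible (`ind_equiv_of_functional`). Irreducibility of π_d^±(θ) is transported along
the composite. -/

lemma sum_out_mul {M : Type*} [AddCommMonoid M] (N : Subgroup G) [Fintype (G ⧸ N)] {F : G → M}
    (hF : ∀ g, ∀ n ∈ N, F (g * n) = F g) (s : G) :
    ∑ q : G ⧸ N, F (s * q.out) = ∑ q : G ⧸ N, F q.out := by
  refine Fintype.sum_equiv (MulAction.toPerm s) _ _ fun q => ?_
  have h : ((s * q.out : G) : G ⧸ N) = (((s • q : G ⧸ N).out : G) : G ⧸ N) := by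
    rw [QuotientGroup.out_eq']
    conv_rhs => rw [← QuotientGroup.out_eq' q]
    rfl
  have h1 := hF (s * q.out) _ (QuotientGroup.eq.1 h)
  rw [mul_inv_cancel_left] at h1
  exact h1.symm

lemma indSpace_apply_mul {V : Type*} [AddCommGroup V] [Module ℂ V] {H : Subgroup G}
    {ρ : Representation ℂ H V} (f : IndSpace H ρ) {h : G} (hh : h ∈ H) (g : G) :
    f.1 (h * g) = ρ ⟨h, hh⟩ (f.1 g) :=
  f.2 ⟨h, hh⟩ g

lemma ind_apply {V : Type*} [AddCommGroup V] [Module ℂ V] {H : Subgroup G}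
    {ρ : Representation ℂ H V} (x : G) (f : IndSpace H ρ) (g : G) :
    (Ind H ρ x f).1 g = f.1 (g * x) := rfl

open Classical in
/-- The function supported on `H` with value `w` at `1`. -/
def indDelta {V : Type*} [AddCommGroup V] [Module ℂ V] (H : Subgroup G)
    (ρ : Representation ℂ H V) (w : V) : IndSpace H ρ :=
  ⟨fun g => if hg : g ∈ H then ρ ⟨g, hg⟩ w else 0, fun h g => by
    change (if hg : (h : G) * g ∈ H then ρ ⟨h * g, hg⟩ w else 0) =
      ρ h (if hg : g ∈ H then ρ ⟨g, hg⟩ w else 0)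
    by_cases hg : g ∈ H
    · rw [dif_pos hg, dif_pos (H.mul_mem h.2 hg), ← Module.End.mul_apply, ← map_mul]
      rfl
    · rw [dif_neg hg, dif_neg (fun h' => hg ((H.mul_mem_cancel_left h.2).1 h')), map_zero]⟩

lemma indDelta_of_mem {V : Type*} [AddCommGroup V] [Module ℂ V] {H : Subgroup G}
    {ρ : Representation ℂ H V} (w : V) {g : G} (hg : g ∈ H) :
    (indDelta H ρ w).1 g = ρ ⟨g, hg⟩ w := dif_pos hg

lemma indDelta_of_notMem {V : Type*} [AddCommGroup V] [Module ℂ V] {H : Subgroup G}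
    {ρ : Representation ℂ H V} (w : V) {g : G} (hg : g ∉ H) :
    (indDelta H ρ w).1 g = 0 := dif_neg hg

lemma indDelta_one {V : Type*} [AddCommGroup V] [Module ℂ V] {H : Subgroup G}
    {ρ : Representation ℂ H V} (w : V) : (indDelta H ρ w).1 1 = w := by
  rw [indDelta_of_mem w H.one_mem, show (⟨1, H.one_mem⟩ : H) = 1 from rfl, map_one]
  rfl

/-- An eigenvector for `S` which is supported on `S` generates the induced representation. -/
lemma eq_top_of_supported {S : Subgroup G} [S.FiniteIndex] {μ : S →* ℂˣ}
    (V : Subrepresentation (Ind S (charRep μ))) {e : IndSpace S (charRep μ)} (he : e ∈ V.toSubmodule)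
    (he1 : e.1 1 ≠ 0) (hsupp : ∀ g ∉ S, e.1 g = 0) (F : IndSpace S (charRep μ)) :
    F ∈ V.toSubmodule := by
  classical
  let _ := Fintype.ofFinite (G ⧸ S)
  -- The translates of e have disjoint supports S q⁻¹, which cover the group, so they form a basis
  -- of the induced space up to scalars. At g only the coset of g⁻¹ contributes.
  have key : F = ∑ q : G ⧸ S, (F.1 q.out⁻¹ / e.1 1) • Ind S (charRep μ) q.out e := by
    apply Subtype.ext
    funext g
    rw [AddSubmonoidClass.coe_finsetSum, Finset.sum_apply,
      Finset.sum_eq_single (QuotientGroup.mk g⁻¹ : G ⧸ S)]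
    · set x := (QuotientGroup.mk g⁻¹ : G ⧸ S).out with hx
      have hgx : g * x ∈ S := by
        have h : ((g⁻¹ : G) : G ⧸ S) = (x : G ⧸ S) := by rw [hx, QuotientGroup.out_eq']
        simpa using QuotientGroup.eq.1 h
      change F.1 g = (F.1 x⁻¹ / e.1 1) * e.1 (g * x)
      have h1 := indSpace_apply_mul F hgx x⁻¹
      have h2 := indSpace_apply_mul e hgx 1
      rw [mul_inv_cancel_right, charRep_apply] at h1
      rw [mul_one, charRep_apply] at h2
      rw [h1, h2]
      field_simp
    · intro q _ hq
      change (F.1 q.out⁻¹ / e.1 1) * e.1 (g * q.out) = 0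
      rw [hsupp (g * q.out), mul_zero]
      intro h
      apply hq
      rw [← QuotientGroup.out_eq' q, eq_comm, QuotientGroup.eq]
      simpa using h
    · simp
  rw [key]
  exact V.toSubmodule.sum_mem fun q _ => V.toSubmodule.smul_mem _ (V.apply_mem_toSubmodule _ he)

/-- Mackey's irreducibility criterion for a representation induced from a character which is
trivial on a normal subgroup of finite index. -/
theorem ind_isIrreducible (S : Subgroup G) (μ : S →* ℂˣ) (N : Subgroup G) [hN : N.Normal]
    [N.FiniteIndex] (hNS : N ≤ S) (hμ : ∀ (n : G) (hn : n ∈ N), μ ⟨n, hNS hn⟩ = 1)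
    (mackey : ∀ g ∉ S, ∃ (x : G) (hx : x ∈ S) (hx' : g * x * g⁻¹ ∈ S),
      μ ⟨g * x * g⁻¹, hx'⟩ ≠ μ ⟨x, hx⟩) :
    (Ind S (charRep μ)).IsIrreducible := by
  have : S.FiniteIndex := Subgroup.finiteIndex_of_le hNS
  let _ := Fintype.ofFinite (S ⧸ N.subgroupOf S)
  have hd : indDelta S (charRep μ) 1 ≠ 0 := fun h => by
    have := congrArg (fun f : IndSpace S (charRep μ) => f.1 1) h
    simp only [indDelta_one] at this
    exact one_ne_zero this
  refine { exists_pair_ne := ⟨⊥, ⊤, fun h => hd ?_⟩, eq_bot_or_eq_top := fun V => ?_ }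
  · have h1 : indDelta S (charRep μ) 1 ∈ (⊤ : Subrepresentation (Ind S (charRep μ))) := trivial
    rw [← h] at h1
    exact h1
  by_cases hV : ∀ f ∈ V.toSubmodule, f = 0
  · left
    apply le_antisymm _ bot_le
    intro f hf
    exact hV f hf
  right
  push Not at hV
  obtain ⟨f, hf, hf0⟩ := hV
  obtain ⟨g₀, hg₀⟩ : ∃ g, f.1 g ≠ 0 := by
    by_contra! h
    exact hf0 (Subtype.ext (funext h))
  -- The space is invariant under translation, so a nonvanishing value may be moved to the identity.
  set f₁ := Ind S (charRep μ) g₀ f with hf₁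
  have hf₁V : f₁ ∈ V.toSubmodule := V.apply_mem_toSubmodule _ hf
  have hf₁1 : f₁.1 1 ≠ 0 := by rwa [hf₁, ind_apply, one_mul]
  -- Normality of N and triviality of the character on N make every function in the induced space
  -- right N-invariant. The projection to the eigenspace of S below is therefore a finite sum over
  -- S/N.
  have hinv : ∀ g n : G, n ∈ N → f₁.1 (g * n) = f₁.1 g := by
    intro g n hn
    have h := hN.conj_mem n hn g
    rw [show g * n = (g * n * g⁻¹) * g by group, indSpace_apply_mul f₁ (hNS h), charRep_apply,
      hμ _ h, Units.val_one, one_mul]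
  set e : IndSpace S (charRep μ) :=
    ∑ q : S ⧸ N.subgroupOf S, ((μ q.out)⁻¹ : ℂˣ).1 • Ind S (charRep μ) q.out f₁ with he
  have heV : e ∈ V.toSubmodule :=
    V.toSubmodule.sum_mem fun q _ => V.toSubmodule.smul_mem _ (V.apply_mem_toSubmodule _ hf₁V)
  have hval : ∀ g, e.1 g =
      ∑ q : S ⧸ N.subgroupOf S, ((μ q.out)⁻¹ : ℂˣ).1 * f₁.1 (g * (q.out : S)) := by
    intro g
    rw [he, AddSubmonoidClass.coe_finsetSum, Finset.sum_apply]
    rfl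
  have heig : ∀ (g : G) (s : S), e.1 (g * s) = μ s * e.1 g := by
    intro g s
    rw [hval, hval, ← sum_out_mul (N.subgroupOf S)
      (F := fun s => ((μ s)⁻¹ : ℂˣ).1 * f₁.1 (g * (s : S))) _ s, Finset.mul_sum]
    · refine Finset.sum_congr rfl fun q _ => ?_
      simp only [map_mul, mul_inv, Units.val_mul, Subgroup.coe_mul, mul_assoc, Units.val_inv_eq_inv_val]
      have := (μ s).ne_zero
      field_simp
    · intro s n hn
      have hn' : (n : G) ∈ N := hn
      rw [map_mul, show μ n = 1 from hμ n hn', mul_one, Subgroup.coe_mul, ← mul_assoc,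
        hinv _ _ hn']
  refine le_antisymm le_top fun F _ => eq_top_of_supported V heV ?_ ?_ F
  · rw [hval]
    -- At the identity left and right translation by S coincide, so all terms of the average are
    -- equal and cannot cancel.
    have : ∀ q : S ⧸ N.subgroupOf S,
        ((μ q.out)⁻¹ : ℂˣ).1 * f₁.1 (1 * (q.out : S)) = f₁.1 1 := by
      intro q
      have h := indSpace_apply_mul f₁ q.out.2 1
      rw [charRep_apply, mul_one] at h
      rw [one_mul, h]
      simp
    rw [Finset.sum_congr rfl fun q _ => this q, Finset.sum_const, nsmul_eq_mul]
    refine mul_ne_zero ?_ hf₁1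
    simp
  · intro g hg
    -- Computing e(g x) from the right and, as e((g x g⁻¹) g), from the left gives two different
    -- multiples of e(g), which forces e(g) = 0.
    obtain ⟨x, hx, hx', hne⟩ := mackey g hg
    have h1 := heig g ⟨x, hx⟩
    have h2 := indSpace_apply_mul e hx' g
    rw [inv_mul_cancel_right, charRep_apply] at h2
    change e.1 (g * x) = _ at h1
    rw [h1] at h2
    by_contra h0
    exact hne (Units.ext (mul_right_cancel₀ h0 h2).symm)

/-- Characters of two subgroups which agree on the intersection induce equivalent representations,
provided that these are irreducible. -/
theorem ind_equiv_of_agree (H S : Subgroup G) [H.FiniteIndex] (χ : H →* ℂˣ) (μ : S →* ℂˣ)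
    (hagree : ∀ (g : G) (hH : g ∈ H) (hS : g ∈ S), χ ⟨g, hH⟩ = μ ⟨g, hS⟩)
    (hirr : (Ind H (charRep χ)).IsIrreducible) (hirr' : (Ind S (charRep μ)).IsIrreducible) :
    Nonempty ((Ind H (charRep χ)).Equiv (Ind S (charRep μ))) := by
  classical
  let _ := Fintype.ofFinite (S ⧸ H.subgroupOf S)
  -- Each term depends only on the coset of s: replacing s by s n with n in H ∩ S multiplies the two
  -- factors by μ(n) and χ(n)⁻¹, which cancel because the characters agree there.
  let T : (IndSpace H (charRep χ)) → G → ℂ := fun f g =>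
    ∑ q : S ⧸ H.subgroupOf S, (μ q.out : ℂ) * f.1 (((q.out : S) : G)⁻¹ * g)
  have hT : ∀ (f : IndSpace H (charRep χ)) (s : S) (g : G), T f (s * g) = μ s * T f g := by
    intro f s g
    have h := sum_out_mul (H.subgroupOf S)
      (F := fun t => (μ t : ℂ) * f.1 (((t : S) : G)⁻¹ * (s * g))) (fun t n hn => by
        have hn' : (n : G) ∈ H := hn
        have h1 := indSpace_apply_mul f (H.inv_mem hn') ((t : G)⁻¹ * (s * g))
        have h2 : χ ⟨(n : G)⁻¹, H.inv_mem hn'⟩ = (μ n)⁻¹ := by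
          rw [← map_inv]
          exact hagree _ (H.inv_mem hn') (S.inv_mem n.2)
        rw [charRep_apply, h2] at h1
        rw [Subgroup.coe_mul, mul_inv_rev, mul_assoc, h1, map_mul, Units.val_mul,
          Units.val_inv_eq_inv_val]
        have := (μ n).ne_zero
        field_simp) s
    change ∑ q : S ⧸ H.subgroupOf S, (μ q.out : ℂ) * f.1 (((q.out : S) : G)⁻¹ * (s * g)) = _
    rw [← h, Finset.mul_sum]
    refine Finset.sum_congr rfl fun q _ => ?_
    rw [map_mul, Units.val_mul, Subgroup.coe_mul, mul_inv_rev, mul_assoc, mul_assoc,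
      inv_mul_cancel_left]
  let A : Representation.IntertwiningMap (Ind H (charRep χ)) (Ind S (charRep μ)) :=
    { toFun := fun f => ⟨T f, hT f⟩
      map_add' := fun f₁ f₂ => by
        apply Subtype.ext
        funext g
        change T (f₁ + f₂) g = T f₁ g + T f₂ g
        simp only [T, ← Finset.sum_add_distrib, ← mul_add]
        rfl
      map_smul' := fun c f => by
        apply Subtype.ext
        funext g
        change T (c • f) g = c * T f g
        simp only [T, Finset.mul_sum, mul_left_comm c]
        rfl
      isIntertwining' := fun x => by
        apply LinearMap.ext
        intro f
        apply Subtype.ext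
        funext g
        change T (Ind H (charRep χ) x f) g = T f (g * x)
        simp only [T, ind_apply, mul_assoc] }
  have hA : A ≠ 0 := by
    intro h
    -- On the function supported on H only the trivial coset survives, and its term is not zero.
    have h1 : T (indDelta H (charRep χ) 1) 1 = 0 :=
      congrArg (fun B : Representation.IntertwiningMap (Ind H (charRep χ)) (Ind S (charRep μ)) =>
        (B (indDelta H (charRep χ) 1)).1 1) h
    have hout : (((QuotientGroup.mk 1 : S ⧸ H.subgroupOf S).out : S) : G) ∈ H := by
      have h : ((1 : S) : S ⧸ H.subgroupOf S) =
        (((QuotientGroup.mk 1 : S ⧸ H.subgroupOf S).out : S) : S ⧸ H.subgroupOf S) := by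
        rw [QuotientGroup.out_eq']
      have h' := QuotientGroup.eq.1 h
      rw [inv_one, one_mul] at h'
      exact h'
    change ∑ q : S ⧸ H.subgroupOf S,
      (μ q.out : ℂ) * (indDelta H (charRep χ) 1).1 (((q.out : S) : G)⁻¹ * 1) = 0 at h1
    rw [Finset.sum_eq_single (QuotientGroup.mk 1 : S ⧸ H.subgroupOf S)] at h1
    · rw [mul_one, indDelta_of_mem _ (H.inv_mem hout), charRep_apply] at h1
      simp at h1
    · intro q _ hq
      rw [indDelta_of_notMem, mul_zero]
      intro h
      rw [mul_one, inv_mem_iff] at h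
      apply hq
      rw [← QuotientGroup.out_eq' q, eq_comm, QuotientGroup.eq, inv_one, one_mul]
      exact h
    · simp
  exact ⟨A.ofBijective ((Representation.IsIrreducible.bijective_or_eq_zero A).resolve_right hA)⟩

/-- A representation induced from a representation `ρ` of `B` is equivalent to one which is induced
from a character of a subgroup `H` of `B`, if the latter is irreducible and there is a functional
on the space of `ρ` which transforms under `H` by the character, and whose translates
separate points. -/
theorem ind_equiv_of_functional {W : Type*} [AddCommGroup W] [Module ℂ W] [Nontrivial W]
    {B H : Subgroup G} (hHB : H ≤ B) (ρ : Representation ℂ B W) (χ : H →* ℂˣ) (l : W →ₗ[ℂ] ℂ)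
    (hl : ∀ (h : H) (w : W), l (ρ ⟨h, hHB h.2⟩ w) = χ h * l w)
    (hsep : ∀ w, (∀ b, l (ρ b w) = 0) → w = 0)
    (hirr : (Ind H (charRep χ)).IsIrreducible) :
    Nonempty ((Ind B ρ).Equiv (Ind H (charRep χ))) := by
  let A : Representation.IntertwiningMap (Ind B ρ) (Ind H (charRep χ)) :=
    { toFun := fun f => ⟨fun g => l (f.1 g), fun h g => by
        have := indSpace_apply_mul f (hHB h.2) g
        change l (f.1 (h * g)) = _
        rw [this, hl]
        rfl⟩
      map_add' := fun f₁ f₂ => by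
        apply Subtype.ext
        funext g
        exact map_add l _ _
      map_smul' := fun c f => by
        apply Subtype.ext
        funext g
        exact map_smul l _ _
      isIntertwining' := fun x => rfl }
  have hval : ∀ f g, (A f).1 g = l (f.1 g) := fun f g => rfl
  -- The values of f on the coset B g are the ρ(b) f(g), so vanishing of l ∘ f on this coset says
  -- that all translates of l kill f(g).
  have hinj : Function.Injective A := by
    intro f₁ f₂ h
    apply Subtype.ext
    funext g
    rw [← sub_eq_zero]
    apply hsep
    intro b
    rw [map_sub, map_sub, ← indSpace_apply_mul f₁ b.2, ← indSpace_apply_mul f₂ b.2, ← hval, ← hval,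
      h, sub_self]
  have hA : A ≠ 0 := by
    intro h
    obtain ⟨w, hw⟩ := exists_ne (0 : W)
    have h1 : indDelta B ρ w = 0 := by
      apply hinj
      rw [h]
      rfl
    apply hw
    rw [← indDelta_one (H := B) (ρ := ρ) w, h1]
    rfl
  exact ⟨A.ofBijective ⟨hinj,
    (Representation.IsIrreducible.surjective_or_eq_zero A).resolve_right hA⟩⟩

lemma isIrreducible_of_equiv {V W : Type*} [AddCommGroup V] [Module ℂ V] [AddCommGroup W]
    [Module ℂ W] {ρ : Representation ℂ G V} {σ : Representation ℂ G W} (e : ρ.Equiv σ)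
    (h : σ.IsIrreducible) : ρ.IsIrreducible := by
  rw [Representation.irreducible_iff_isSimpleModule_asModule] at h ⊢
  exact IsSimpleModule.congr (LinearEquiv.ofBijective
    (Representation.IntertwiningMap.equivLinearMapAsModule ρ σ e.toIntertwiningMap)
    e.toLinearEquiv.bijective)

end Mackey

/-! ### The Mackey condition for subgroups of SL₂(R) defined by congruences. -/

section LocalMackey

variable {k : Type*} [Field k] [ValuativeRel k] [TopologicalSpace k] [IsNonarchimedeanLocalField k]

/-- Only the left column is needed: membership in the groups below, and the values of their
characters near the identity, depend on these two entries alone. -/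
lemma conj_00 (g x : SL(2, 𝒪[k])) : (g * x * g⁻¹) 0 0 =
    (g 0 0 * x 0 0 + g 0 1 * x 1 0) * g 1 1 - (g 0 0 * x 0 1 + g 0 1 * x 1 1) * g 1 0 := by
  rw [mul_00, mul_00, mul_01, inv_00, inv_10]
  ring

lemma conj_10 (g x : SL(2, 𝒪[k])) : (g * x * g⁻¹) 1 0 =
    (g 1 0 * x 0 0 + g 1 1 * x 1 0) * g 1 1 - (g 1 0 * x 0 1 + g 1 1 * x 1 1) * g 1 0 := by
  rw [mul_10, mul_10, mul_11, inv_00, inv_10]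
  ring

/-- An element of `SL₂(R)` with given entries. -/
abbrev slOf (a b c e : 𝒪[k]) (h : a * e - b * c = 1) : SL(2, 𝒪[k]) :=
  ⟨!![a, b; c, e], by rw [Matrix.det_fin_two_of, h]⟩

lemma mem_pow_iff {ϖ : 𝒪[k]} (hϖ : Irreducible ϖ) {n : ℕ} {x : 𝒪[k]} :
    x ∈ 𝓂[k] ^ n ↔ ϖ ^ n ∣ x := by
  rw [hϖ.maximalIdeal_eq, Ideal.span_singleton_pow, Ideal.mem_span_singleton]

lemma pow_mul_mem {ϖ : 𝒪[k]} (hϖ : Irreducible ϖ) {n m : ℕ} (h : n ≤ m) (x : 𝒪[k]) :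
    ϖ ^ m * x ∈ 𝓂[k] ^ n :=
  (mem_pow_iff hϖ).2 ((pow_dvd_pow _ h).trans (dvd_mul_right _ _))

lemma exists_eq_pow_mul_unit {ϖ : 𝒪[k]} (hϖ : Irreducible ϖ) {n : ℕ} {x : 𝒪[k]}
    (hx : x ∉ 𝓂[k] ^ n) : ∃ l < n, ∃ w : 𝒪[k]ˣ, x = ϖ ^ l * w := by
  have hx0 : x ≠ 0 := by
    rintro rfl
    exact hx (zero_mem _)
  obtain ⟨l, w, hw⟩ := IsDiscreteValuationRing.associated_pow_irreducible hx0 hϖ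
  refine ⟨l, ?_, w⁻¹, by rw [← hw]; simp⟩
  by_contra! h
  apply hx
  rw [show x = ϖ ^ l * (w⁻¹ : 𝒪[k]ˣ) by rw [← hw]; simp]
  exact pow_mul_mem hϖ h _

/-- This carries a lower left entry in P^d back to R, where Ψ depends only on the residue class. -/
lemma unifPow_mul {ϖ : 𝒪[k]} (hϖ : Irreducible ϖ) (d : ℕ) (a : 𝒪[k]ˣ) (r : 𝒪[k]) :
    unifPow ϖ d a * ((ϖ ^ d * r : 𝒪[k]) : k) = ((a * r : 𝒪[k]) : k) := by
  have h := unif_ne hϖ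
  rw [unifPow]
  push_cast
  rw [zpow_neg, zpow_natCast]
  field_simp

lemma isUnit_two (hp : ringChar 𝓀[k] ≠ 2) : IsUnit (2 : 𝒪[k]) := by
  by_contra h
  have h2 : (2 : 𝒪[k]) ∈ 𝓂[k] := (IsLocalRing.mem_maximalIdeal _).2 h
  rw [← IsLocalRing.residue_eq_zero_iff, map_ofNat] at h2
  exact Ring.two_ne_zero hp h2

lemma isUnit_of_sub_one_mem {x : 𝒪[k]} (h : x - 1 ∈ 𝓂[k]) : IsUnit x := by
  by_contra hx
  have := sub_mem ((IsLocalRing.mem_maximalIdeal x).2 hx) h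
  rw [sub_sub_cancel] at this
  exact (IsLocalRing.mem_maximalIdeal _).1 this isUnit_one

/-- The principal congruence subgroup of level `n`. -/
abbrev congruenceGroup (k : Type*) [Field k] [ValuativeRel k] [TopologicalSpace k]
    [IsNonarchimedeanLocalField k] (n : ℕ) : Subgroup SL(2, 𝒪[k]) :=
  (Matrix.SpecialLinearGroup.map (n := Fin 2) (Ideal.Quotient.mk (𝓂[k] ^ n))).ker

/-- The quotient embeds in SL₂(R / P^n), which is finite because κ is finite. -/
instance (n : ℕ) : (congruenceGroup k n).FiniteIndex := by
  have h1 : Finite (𝒪[k] ⧸ 𝓂[k]) := inferInstanceAs (Finite 𝓀[k])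
  have h2 : Finite (𝒪[k] ⧸ 𝓂[k] ^ n) := Ideal.finite_quotient_pow (IsNoetherian.noetherian _) n
  have h3 : Finite SL(2, 𝒪[k] ⧸ 𝓂[k] ^ n) := inferInstanceAs (Finite { _A // _ })
  infer_instance

lemma congruenceGroup_entries {n : ℕ} {g : SL(2, 𝒪[k])} (hg : g ∈ congruenceGroup k n) :
    g 0 0 - 1 ∈ 𝓂[k] ^ n ∧ g 1 0 ∈ 𝓂[k] ^ n := by
  rw [MonoidHom.mem_ker] at hg
  constructor
  · have : Ideal.Quotient.mk (𝓂[k] ^ n) (g 0 0) = 1 := by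
      simpa using congrArg (fun h : SL(2, 𝒪[k] ⧸ 𝓂[k] ^ n) => h 0 0) hg
    rw [← Ideal.Quotient.eq_zero_iff_mem, map_sub, this, map_one, sub_self]
  · have : Ideal.Quotient.mk (𝓂[k] ^ n) (g 1 0) = 0 := by
      simpa using congrArg (fun h : SL(2, 𝒪[k] ⧸ 𝓂[k] ^ n) => h 1 0) hg
    rwa [← Ideal.Quotient.eq_zero_iff_mem]

variable {ϖ : 𝒪[k]} {d m n : ℕ}

/-- Irreducibility of the representations induced from the characters `g ↦ Ψ(a ϖ^(-d) g₂₁)`,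
extended by a character of the center, of the groups of matrices with lower left
entry in `P^m` and diagonal entries in `±1 + P^n`, where `m + n = d + 1`. -/
theorem ind_isIrreducible_of_level (hp : ringChar 𝓀[k] ≠ 2) (hϖ : Irreducible ϖ)
    {Ψ : AddChar k ℂ} (hΨ : IsBasic Ψ) (a : 𝒪[k]ˣ) (hmn : m + n = d + 1) (hn : 0 < n)
    (hnm : n ≤ m) (S : Subgroup SL(2, 𝒪[k])) (μ : S →* ℂˣ)
    (hS : ∀ g, g ∈ S ↔ g 1 0 ∈ 𝓂[k] ^ m ∧ g 0 0 ^ 2 - 1 ∈ 𝓂[k] ^ n)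
    (hμ : ∀ g (hg : g ∈ S), g 0 0 - 1 ∈ 𝓂[k] ^ n →
      (μ ⟨g, hg⟩ : ℂ) = Ψ (unifPow ϖ d a * (g 1 0 : 𝒪[k]))) :
    (Ind S (charRep μ)).IsIrreducible := by
  have hle : 𝓂[k] ^ m ≤ 𝓂[k] ^ n := Ideal.pow_le_pow_right hnm
  have hS' : ∀ g : SL(2, 𝒪[k]), g 1 0 ∈ 𝓂[k] ^ m → g 0 0 - 1 ∈ 𝓂[k] ^ n → g ∈ S := by
    intro g h1 h2
    refine (hS g).2 ⟨h1, ?_⟩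
    rw [show g 0 0 ^ 2 - 1 = (g 0 0 + 1) * (g 0 0 - 1) by ring]
    exact Ideal.mul_mem_left _ _ h2
  have hN : ∀ g ∈ congruenceGroup k (d + 1), g 1 0 ∈ 𝓂[k] ^ m ∧ g 0 0 - 1 ∈ 𝓂[k] ^ n := by
    intro g hg
    obtain ⟨h1, h2⟩ := congruenceGroup_entries hg
    exact ⟨Ideal.pow_le_pow_right (by omega) h2, Ideal.pow_le_pow_right (by omega) h1⟩
  obtain ⟨t, ht⟩ := hΨ.2
  -- Level d + 1 suffices for triviality of the character, since a ϖ^(-d) P^(d+1) = P lies in the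
  -- kernel of Ψ.
  refine ind_isIrreducible S μ (congruenceGroup k (d + 1)) (fun g hg => hS' g (hN g hg).1 (hN g hg).2)
    (fun g hg => ?_) fun g hg => ?_
  · rw [← Units.val_inj, hμ _ _ (hN g hg).2]
    obtain ⟨y, hy⟩ := (mem_pow_iff hϖ).1 (congruenceGroup_entries hg).2
    rw [hy, pow_succ, mul_assoc (ϖ ^ d), unifPow_mul hϖ, hΨ.1, Units.val_one]
    rw [hϖ.maximalIdeal_eq]
    exact Ideal.mul_mem_left _ _ (Ideal.mul_mem_right _ _ (Ideal.mem_span_singleton_self ϖ))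
  -- The Mackey condition reduces to finding x for which conjugation by g shifts the lower left
  -- entry by ϖ^d r with a r ≡ t: the two character values then differ by the factor Ψ(t) ≠ 1. Three
  -- kinds of x are needed, according to the valuation of g₂₁.
  have key : ∀ x : SL(2, 𝒪[k]), x 1 0 ∈ 𝓂[k] ^ m → x 0 0 - 1 ∈ 𝓂[k] ^ n →
      (g * x * g⁻¹) 1 0 ∈ 𝓂[k] ^ m → (g * x * g⁻¹) 0 0 - 1 ∈ 𝓂[k] ^ n →
      (∃ r : 𝒪[k], (g * x * g⁻¹) 1 0 - x 1 0 = ϖ ^ d * r ∧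
        IsLocalRing.residue 𝒪[k] (a * r) = IsLocalRing.residue 𝒪[k] t) →
      ∃ (x : SL(2, 𝒪[k])) (hx : x ∈ S) (hx' : g * x * g⁻¹ ∈ S),
        μ ⟨g * x * g⁻¹, hx'⟩ ≠ μ ⟨x, hx⟩ := by
    rintro x h1 h2 h3 h4 ⟨r, hr, hr'⟩
    refine ⟨x, hS' x h1 h2, hS' _ h3 h4, fun h => ht ?_⟩
    rw [← Units.val_inj, hμ _ _ h2, hμ _ _ h4, sub_eq_iff_eq_add.1 hr] at h
    rw [← hΨ.eq hr', ← unifPow_mul hϖ d a r]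
    rw [Subring.coe_add, mul_add, AddChar.map_add_eq_mul] at h
    refine mul_right_cancel₀ (AddChar.val_isUnit Ψ _).ne_zero (h.trans (one_mul _).symm)
  have hdet := det_eq g
  by_cases hc : g 1 0 ∈ 𝓂[k] ^ m
  · have hd : g 1 1 ^ 2 - 1 ∉ 𝓂[k] ^ n := by
      intro h
      apply hg
      refine (hS g).2 ⟨hc, ?_⟩
      rw [show g 0 0 ^ 2 - 1 = -(g 0 0 ^ 2) * (g 1 1 ^ 2 - 1) +
        (g 0 1 * (2 + g 0 1 * g 1 0)) * g 1 0 by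
          linear_combination (g 0 0 * g 1 1 + 1 + g 0 1 * g 1 0) * hdet]
      exact add_mem (Ideal.mul_mem_left _ _ h) (Ideal.mul_mem_left _ _ (hle hc))
    obtain ⟨l, hl, w, hw⟩ := exists_eq_pow_mul_unit hϖ hd
    -- For x lower unipotent with entry e the shift is (g₂₂² - 1) e = ϖ^l w e, which dictates e. The
    -- bound l < n gives d - l ≥ m, so that x lies in S.
    set e := ϖ ^ (d - l) * ((a⁻¹ * w⁻¹ : 𝒪[k]ˣ) * t) with he
    have hem : e ∈ 𝓂[k] ^ m := pow_mul_mem hϖ (by omega) _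
    refine key (slOf 1 0 e 1 (by ring)) hem ?_ ?_ ?_ ⟨(a⁻¹ : 𝒪[k]ˣ) * t, ?_, ?_⟩
    · change (1 : 𝒪[k]) - 1 ∈ _
      simp
    · rw [conj_10]
      change (g 1 0 * 1 + g 1 1 * e) * g 1 1 - (g 1 0 * 0 + g 1 1 * 1) * g 1 0 ∈ _
      rw [show (g 1 0 * 1 + g 1 1 * e) * g 1 1 - (g 1 0 * 0 + g 1 1 * 1) * g 1 0 =
        g 1 1 ^ 2 * e by ring]
      exact Ideal.mul_mem_left _ _ hem
    · rw [conj_00]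
      change (g 0 0 * 1 + g 0 1 * e) * g 1 1 - (g 0 0 * 0 + g 0 1 * 1) * g 1 0 - 1 ∈ _
      rw [show (g 0 0 * 1 + g 0 1 * e) * g 1 1 - (g 0 0 * 0 + g 0 1 * 1) * g 1 0 - 1 =
        (g 0 1 * g 1 1) * e by linear_combination hdet]
      exact Ideal.mul_mem_left _ _ (hle hem)
    · rw [conj_10]
      change (g 1 0 * 1 + g 1 1 * e) * g 1 1 - (g 1 0 * 0 + g 1 1 * 1) * g 1 0 - e = _
      have hww : (w : 𝒪[k]) * (w⁻¹ : 𝒪[k]ˣ) = 1 := w.mul_inv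
      rw [show d = l + (d - l) by omega, pow_add, show l + (d - l) - l = d - l by omega] at *
      rw [Units.val_mul] at he
      linear_combination e * hw + (ϖ ^ l * (w : 𝒪[k])) * he +
        (ϖ ^ l * ϖ ^ (d - l) * (a⁻¹ : 𝒪[k]ˣ) * t) * hww
    · rw [Units.mul_inv_cancel_left]
  obtain ⟨j, hj, w, hw⟩ := exists_eq_pow_mul_unit hϖ hc
  rcases Nat.eq_zero_or_pos j with rfl | hj0
  · rw [pow_zero, one_mul] at hw
    have hww : (w : 𝒪[k]) * (w⁻¹ : 𝒪[k]ˣ) = 1 := w.mul_inv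
    -- If g₂₁ = w is a unit, x is upper unipotent with entry ϖ^d r. Its lower left entry becomes
    -- -ϖ^d r w² after conjugation, which dictates r.
    set r : 𝒪[k] := -((a⁻¹ : 𝒪[k]ˣ) * (w⁻¹ : 𝒪[k]ˣ) ^ 2 * t) with hr
    have h10 : (g * slOf 1 (ϖ ^ d * r) 0 1 (by ring) * g⁻¹) 1 0 =
        ϖ ^ d * ((a⁻¹ : 𝒪[k]ˣ) * t) := by
      rw [conj_10]
      change (g 1 0 * 1 + g 1 1 * 0) * g 1 1 - (g 1 0 * (ϖ ^ d * r) + g 1 1 * 1) * g 1 0 = _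
      rw [hw, hr]
      linear_combination (ϖ ^ d * (a⁻¹ : 𝒪[k]ˣ) * t) * ((w : 𝒪[k]) * (w⁻¹ : 𝒪[k]ˣ) + 1) * hww
    refine key (slOf 1 (ϖ ^ d * r) 0 1 (by ring)) (zero_mem _) ?_ ?_ ?_
      ⟨(a⁻¹ : 𝒪[k]ˣ) * t, ?_, ?_⟩
    · change (1 : 𝒪[k]) - 1 ∈ _
      simp
    · rw [h10]
      exact pow_mul_mem hϖ (by omega) _
    · rw [conj_00]
      change (g 0 0 * 1 + g 0 1 * 0) * g 1 1 - (g 0 0 * (ϖ ^ d * r) + g 0 1 * 1) * g 1 0 - 1 ∈ _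
      rw [show (g 0 0 * 1 + g 0 1 * 0) * g 1 1 - (g 0 0 * (ϖ ^ d * r) + g 0 1 * 1) * g 1 0 - 1 =
        ϖ ^ d * (-(g 0 0 * r * g 1 0)) by linear_combination hdet]
      exact pow_mul_mem hϖ (by omega) _
    · rw [h10]
      exact sub_zero _
    · rw [Units.mul_inv_cancel_left]
  · have hc1 : g 1 0 ∈ 𝓂[k] := by
      rw [hw, ← pow_one 𝓂[k]]
      exact pow_mul_mem hϖ hj0 _
    have hd1 : IsUnit (g 1 1) := by
      have : IsUnit (g 0 0 * g 1 1) := by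
        refine isUnit_of_sub_one_mem ?_
        rw [show g 0 0 * g 1 1 - 1 = g 0 1 * g 1 0 by linear_combination hdet]
        exact Ideal.mul_mem_left _ _ hc1
      exact isUnit_of_mul_isUnit_right this
    obtain ⟨v, hv⟩ := hd1
    obtain ⟨two, htwo⟩ := isUnit_two hp
    -- If g₂₁ = ϖ^j w with 0 < j < m, x is diag(α, α⁻¹) with α = 1 + ϖ^i r. The shift is g₂₁ g₂₂ (α
    -- - α⁻¹), equal to 2 ϖ^d w v r to leading order. Hence r is divided by 2, a unit in odd residue
    -- characteristic. The bound j < m gives i ≥ n ≥ 1.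
    set i := d - j with hi
    set r : 𝒪[k] := (a⁻¹ * w⁻¹ * v⁻¹ * two⁻¹ : 𝒪[k]ˣ) * t with hr
    have hm : ϖ ^ i * r ∈ 𝓂[k] := by
      rw [← pow_one 𝓂[k]]
      exact pow_mul_mem hϖ (by omega) _
    obtain ⟨α, hα⟩ := isUnit_of_sub_one_mem (x := 1 + ϖ ^ i * r) (by rwa [add_sub_cancel_left])
    have hαα : (α : 𝒪[k]) * (α⁻¹ : 𝒪[k]ˣ) = 1 := α.mul_inv
    set β : 𝒪[k] := ↑(α⁻¹) with hβ
    -- This is α - α⁻¹ = α⁻¹ (α² - 1).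
    have hβ1 : α - β = ϖ ^ i * (β * r * (2 + ϖ ^ i * r)) := by
      linear_combination (α + 1 + ϖ ^ i * r) * β * hα - (α : 𝒪[k]) * hαα
    have hres : IsLocalRing.residue 𝒪[k] (ϖ ^ i * r) = 0 := (IsLocalRing.residue_eq_zero_iff _).2 hm
    have hαres : IsLocalRing.residue 𝒪[k] α = 1 := by
      rw [hα, map_add, hres, map_one, add_zero]
    have hβres : IsLocalRing.residue 𝒪[k] β = 1 := by
      have := congrArg (IsLocalRing.residue 𝒪[k]) hαα
      rwa [map_mul, hαres, map_one, one_mul] at this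
    have hdet' : (α : 𝒪[k]) * β - 0 * 0 = 1 := by rw [hαα]; ring
    have h10 : (g * slOf (α : 𝒪[k]) 0 0 β hdet' * g⁻¹) 1 0 =
        ϖ ^ d * (w * v * (β * r * (2 + ϖ ^ i * r))) := by
      rw [conj_10]
      change (g 1 0 * α + g 1 1 * 0) * g 1 1 - (g 1 0 * 0 + g 1 1 * β) * g 1 0 = _
      rw [show (g 1 0 * α + g 1 1 * 0) * g 1 1 - (g 1 0 * 0 + g 1 1 * β) * g 1 0 =
        g 1 0 * g 1 1 * (α - β) by ring, hβ1, hw, ← hv, show d = j + i by omega, pow_add]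
      ring
    refine key (slOf (α : 𝒪[k]) 0 0 β hdet') (zero_mem _) ?_ ?_ ?_
      ⟨w * v * (β * r * (2 + ϖ ^ i * r)), ?_, ?_⟩
    · change (α : 𝒪[k]) - 1 ∈ _
      rw [hα, add_sub_cancel_left]
      exact pow_mul_mem hϖ (by omega) _
    · rw [h10]
      exact pow_mul_mem hϖ (by omega) _
    · rw [conj_00]
      change (g 0 0 * α + g 0 1 * 0) * g 1 1 - (g 0 0 * 0 + g 0 1 * β) * g 1 0 - 1 ∈ _
      rw [show (g 0 0 * α + g 0 1 * 0) * g 1 1 - (g 0 0 * 0 + g 0 1 * β) * g 1 0 - 1 =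
        ϖ ^ i * (r + g 0 1 * (β * r * (2 + ϖ ^ i * r)) * g 1 0) by
          linear_combination (α : 𝒪[k]) * hdet + g 0 1 * g 1 0 * hβ1 + hα]
      exact pow_mul_mem hϖ (by omega) _
    · rw [h10]
      exact sub_zero _
    -- The exact factors β and 2 + ϖ^i r may be replaced by 1 and 2, since only the residue of the
    -- shift matters.
    · have e1 : (a : 𝒪[k]) * (w * v * (β * r * 2)) = β * t := by
        rw [hr, ← htwo]
        have e2 : (a * w * v * two * (a⁻¹ * w⁻¹ * v⁻¹ * two⁻¹) : 𝒪[k]ˣ) = 1 := by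
          rw [← mul_inv, ← mul_inv, ← mul_inv, mul_inv_cancel]
        have e3 := congrArg Units.val e2
        simp only [Units.val_mul, Units.val_one] at e3 ⊢
        linear_combination β * t * e3
      rw [show (a : 𝒪[k]) * (w * v * (β * r * (2 + ϖ ^ i * r))) =
        a * (w * v * (β * r * 2)) + (a * w * v * β * r) * (ϖ ^ i * r) by ring, e1, map_add, map_mul,
        map_mul, hres, hβres]
      ring

end LocalMackey

/-! ### From a scalar action on a functional to a character. -/

section Character

/-- A group which acts by scalars on a nonzero functional acts through a character. -/
lemma exists_char_of_functional {H W : Type*} [Group H] [AddCommGroup W] [Module ℂ W]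
    (ρ : Representation ℂ H W) {l : W →ₗ[ℂ] ℂ} (hl : l ≠ 0)
    (h : ∀ g, ∃ c : ℂ, ∀ w, l (ρ g w) = c * l w) :
    ∃ χ : H →* ℂˣ, ∀ g w, l (ρ g w) = χ g * l w := by
  obtain ⟨w₀, hw₀⟩ : ∃ w, l w ≠ 0 := by
    by_contra! h
    exact hl (LinearMap.ext h)
  choose c hc using h
  refine ⟨MonoidHom.toHomUnits
    { toFun := c
      map_one' := ?_
      map_mul' := fun g h => ?_ }, fun g w => hc g w⟩
  · apply mul_right_cancel₀ hw₀
    rw [← hc, map_one, one_mul]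
    rfl
  · apply mul_right_cancel₀ hw₀
    rw [← hc, map_mul, Module.End.mul_apply, hc, hc, mul_assoc]

end Character

/-! ### The functional on σ₀^± over the residue field. -/

section FiniteFunctional

variable {F E : Type*} [Field F] [Finite F] [Field E] [Fintype E] [Algebra F E]
  [Algebra.IsQuadraticExtension F E] {ψ : AddChar F ℂ}

variable (F) in
/-- The Weyl element of `SL₂(F)`. -/
def weyl : SL(2, F) := ⟨!![0, 1; -1, 0], by simp [Matrix.det_fin_two_of]⟩

/-- The Weyl element conjugates lower triangular matrices to upper triangular ones, which act in the
Weil representation by a multiplier and a dilation. Thus evaluation after the Weyl transform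
diagonalizes the lower unipotents. -/
lemma weilOp_weyl_mul (hψ : ψ ≠ 1) {g : SL(2, F)} (hg : g 0 1 = 0) (f : E → ℂ) (x : E) :
    weilOp ψ (weyl F) (weilOp ψ g f) x =
      ψ (-(g 1 1 * g 1 0 * Algebra.norm F x)) * weilOp ψ (weyl F) f (algebraMap F E (g 1 1) * x) := by
  have hdet : g 1 1 * g 0 0 - -g 1 0 * 0 = 1 := by
    have := g.2
    rw [Matrix.det_fin_two] at this
    linear_combination this + g 1 0 * hg
  set g' : SL(2, F) := ⟨!![g 1 1, -g 1 0; 0, g 0 0], by rw [Matrix.det_fin_two_of, hdet]⟩ with hg'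
  have h : weyl F * g = g' * weyl F := by
    ext i j
    rw [Matrix.SpecialLinearGroup.coe_mul, Matrix.SpecialLinearGroup.coe_mul, Matrix.mul_apply,
      Matrix.mul_apply, Fin.sum_univ_two, Fin.sum_univ_two]
    fin_cases i <;> fin_cases j <;> simp [weyl, hg', hg]
  rw [← weilOp_mul hψ, h, weilOp_mul hψ, weilOp_of_eq (g := g') rfl]
  change ψ (g 1 1 * -g 1 0 * _) * _ = _
  rw [mul_neg, neg_mul]
  rfl

lemma weilOp_injective (hψ : ψ ≠ 1) (g : SL(2, F)) :
    Function.Injective (weilOp (E := E) ψ g) := by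
  intro f₁ f₂ h
  have := congrArg (weilOp ψ g⁻¹) h
  rwa [← weilOp_mul hψ, ← weilOp_mul hψ, inv_mul_cancel, weilOp_one, weilOp_one] at this

/-- The element `-1` of the kernel of the norm. -/
def negOneKer (F E : Type*) [Field F] [Finite F] [Field E] [Fintype E] [Algebra F E]
    [Algebra.IsQuadraticExtension F E] : normKer F E :=
  ⟨-1, by
    rw [MonoidHom.mem_ker]
    ext
    change Algebra.norm F (-1 : E) = 1
    rw [norm_neg', map_one]⟩

lemma negOneKer_mul (x : E) : ((negOneKer F E : Eˣ) : E) * x = -x := by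
  change (-1 : E) * x = -x
  ring

lemma omega_negOneKer_sq {ω : normKer F E →* ℂˣ} : ((ω (negOneKer F E) : ℂˣ) : ℂ) ^ 2 = 1 := by
  have : (negOneKer F E) ^ 2 = 1 := by
    apply Subtype.ext
    apply Units.ext
    change (-1 : E) ^ 2 = 1
    ring
  rw [← Units.val_pow_eq_pow_val, ← map_pow, this, map_one, Units.val_one]

variable (hψ : ψ ≠ 1) (h2 : ringChar F ≠ 2) {ω₀ : normKer F E →* ℂˣ} (hω : ω₀ ≠ 1)
  (hω2 : ω₀ ^ 2 = 1) {s : ℤˣ}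

/-- The value at `x₀` of the transform of a function by the Weyl element. -/
def weylFunctional (x₀ : E) :
    (sigmaHalf (E := E) ψ hψ h2 ω₀ hω hω2 s).toSubmodule →ₗ[ℂ] ℂ where
  toFun w := weilOp ψ (weyl F) w.1 x₀
  map_add' w₁ w₂ := congrFun (weilOp_add (weyl F) w₁.1 w₂.1) x₀
  map_smul' c w := congrFun (weilOp_smul (weyl F) c w.1) x₀

lemma weylFunctional_lower (x₀ : E) {g : SL(2, F)} (hg : g 0 1 = 0)
    (w : (sigmaHalf (E := E) ψ hψ h2 ω₀ hω hω2 s).toSubmodule) :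
    weylFunctional hψ h2 hω hω2 x₀ ((sigmaHalf ψ hψ h2 ω₀ hω hω2 s).toRepresentation g w) =
      ψ (-(g 1 1 * g 1 0 * Algebra.norm F x₀)) *
        weylFunctional hψ h2 hω hω2 (algebraMap F E (g 1 1) * x₀) w :=
  weilOp_weyl_mul hψ hg w.1 x₀

lemma weylFunctional_neg (x₀ : E) (w : (sigmaHalf (E := E) ψ hψ h2 ω₀ hω hω2 s).toSubmodule) :
    weylFunctional hψ h2 hω hω2 (-x₀) w =
      ω₀ (negOneKer F E) * weylFunctional hψ h2 hω hω2 x₀ w := by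
  rw [← negOneKer_mul (F := F)]
  exact weilOp_normKer (weyl F) w.1 _ _ (w.2.1 (negOneKer F E)) x₀

/-- Two norms with the same sign have a square product b². Scaling x₀ by c = b / N(x₀) gives it the
norm of x, and x differs from c x₀ by an element of norm one. -/
lemma exists_mul_of_hasSign {x₀ x : E} (h₀ : HasSign s (Algebra.norm F x₀))
    (h : HasSign s (Algebra.norm F x)) :
    ∃ c : F, c ≠ 0 ∧ ∃ t : normKer F E, x = (t : Eˣ) * (algebraMap F E c * x₀) := by
  have hx₀ : x₀ ≠ 0 := by
    rintro rfl
    exact h₀.1 (Algebra.norm_zero ..)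
  have hsq : IsSquare (Algebra.norm F x₀ * Algebra.norm F x) := by
    by_cases hs : s = 1
    · exact (h₀.2.2 hs).mul (h.2.2 hs)
    · exact isSquare_mul_of_not (fun h' => hs (h₀.2.1 h')) (fun h' => hs (h.2.1 h'))
  obtain ⟨b, hb⟩ := hsq
  have hN := h₀.1
  have hb0 : b ≠ 0 := by
    rintro rfl
    exact mul_ne_zero h₀.1 h.1 (hb.trans (mul_zero 0))
  have hc0 : b / Algebra.norm F x₀ ≠ 0 := div_ne_zero hb0 hN
  have hcx : algebraMap F E (b / Algebra.norm F x₀) * x₀ ≠ 0 := mul_ne_zero (by simpa using hc0) hx₀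
  have hx : x ≠ 0 := by
    rintro rfl
    exact h.1 (Algebra.norm_zero ..)
  have hnorm : Algebra.norm F (x / (algebraMap F E (b / Algebra.norm F x₀) * x₀)) = 1 := by
    have h1 : Algebra.norm F (algebraMap F E (b / Algebra.norm F x₀) * x₀) ≠ 0 := by
      rwa [Ne, Algebra.norm_eq_zero_iff]
    apply mul_right_cancel₀ h1
    rw [← map_mul, div_mul_cancel₀ _ hcx, norm_algebraMap_mul]
    field_simp
    linear_combination hb
  refine ⟨b / Algebra.norm F x₀, hc0, ⟨Units.mk0 _ (div_ne_zero hx hcx), ?_⟩, ?_⟩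
  · rw [MonoidHom.mem_ker]
    ext
    exact hnorm
  · change x = x / _ * _
    rw [div_mul_cancel₀ _ hcx]

/-- The Weyl transform of w lies again in σ₀^±, so it is equivariant under the kernel of the norm
and supported on the orbits of the multiples c x₀. Vanishing at these points makes it zero, and the
Weyl element acts injectively. -/
lemma eq_zero_of_weylFunctional {x₀ : E} (h₀ : HasSign s (Algebra.norm F x₀))
    (w : (sigmaHalf (E := E) ψ hψ h2 ω₀ hω hω2 s).toSubmodule)
    (hw : ∀ c : F, c ≠ 0 → weylFunctional hψ h2 hω hω2 (algebraMap F E c * x₀) w = 0) : w = 0 := by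
  apply Subtype.ext
  apply weilOp_injective hψ (weyl F)
  funext x
  have hz : weilOp ψ (weyl F) (0 : E → ℂ) x = 0 := by
    have := congrFun (weilOp_smul (ψ := ψ) (weyl F) 0 (0 : E → ℂ)) x
    rw [zero_smul, zero_smul] at this
    exact this
  refine Eq.trans ?_ hz.symm
  by_cases hx : HasSign s (Algebra.norm F x)
  · obtain ⟨c, hc, t, rfl⟩ := exists_mul_of_hasSign h₀ hx
    have h1 := weilOp_normKer (ψ := ψ) (weyl F) w.1 _ t (w.2.1 t) (algebraMap F E c * x₀)
    rw [h1]
    exact mul_eq_zero_of_right _ (hw c hc)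
  · exact sum_support h2 hω hω2 s (weyl F) w.2.1 w.2.2 x hx

/-- Witnessed by the function equal to ω₀(t) at t x₀ and zero off this orbit. It shows that σ₀^± is
nonzero, and it makes the central character of σ₀ readable from one value. -/
lemma exists_sigmaHalf_ne {x₀ : E} (h₀ : HasSign s (Algebra.norm F x₀)) :
    ∃ w : (sigmaHalf (E := E) ψ hψ h2 ω₀ hω hω2 s).toSubmodule, w.1 x₀ ≠ 0 := by
  classical
  have hx₀ : x₀ ≠ 0 := by
    rintro rfl
    exact h₀.1 (Algebra.norm_zero ..)
  let f : E → ℂ := fun x => ∑ t : normKer F E, if x = (t : Eˣ) * x₀ then (ω₀ t : ℂ) else 0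
  have hval : ∀ t : normKer F E, f ((t : Eˣ) * x₀) = ω₀ t := by
    intro t
    change ∑ t' : normKer F E, _ = _
    rw [Finset.sum_eq_single t, if_pos rfl]
    · intro t' _ ht'
      rw [if_neg]
      intro h
      exact ht' (Subtype.ext (Units.ext (mul_right_cancel₀ hx₀ h))).symm
    · simp
  refine ⟨⟨f, fun t x => ?_, fun x hx => ?_⟩, ?_⟩
  · change ∑ t' : normKer F E, _ = _ * ∑ t' : normKer F E, _
    rw [Finset.mul_sum]
    symm
    refine Fintype.sum_equiv (Equiv.mulLeft t) _ _ fun t' => ?_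
    have : (((t : Eˣ) : E) * x = (((t * t' : normKer F E) : Eˣ) : E) * x₀) ↔
        x = ((t' : Eˣ) : E) * x₀ := by
      rw [Subgroup.coe_mul, Units.val_mul, mul_assoc]
      exact mul_right_inj' (t : Eˣ).ne_zero
    simp only [Equiv.coe_mulLeft, this, mul_ite, mul_zero, map_mul, Units.val_mul]
  · change ∑ t' : normKer F E, _ = _
    refine Finset.sum_eq_zero fun t _ => if_neg ?_
    rintro rfl
    apply hx
    rwa [map_mul, norm_normKer, one_mul]
  · change f x₀ ≠ 0
    have := hval 1
    rw [show (((1 : normKer F E) : Eˣ) : E) * x₀ = x₀ from one_mul x₀] at this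
    rw [this]
    exact (ω₀ 1).ne_zero

end FiniteFunctional

/-! ### The center {±1} and the reduction to diagonal entries near 1. -/

section Center

variable {k : Type*} [Field k] [ValuativeRel k] [TopologicalSpace k] [IsNonarchimedeanLocalField k]

/-- The factors x + 1 and x - 1 differ by the unit 2, so one of them is a unit and the other absorbs
the whole power of the maximal ideal. -/
lemma sub_one_mem_or (hp : ringChar 𝓀[k] ≠ 2) {n : ℕ} {x : 𝒪[k]} (h : x ^ 2 - 1 ∈ 𝓂[k] ^ n) :
    x - 1 ∈ 𝓂[k] ^ n ∨ x + 1 ∈ 𝓂[k] ^ n := by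
  rw [show x ^ 2 - 1 = (x + 1) * (x - 1) by ring] at h
  by_cases hx : IsUnit (x + 1)
  · exact Or.inl ((Ideal.unit_mul_mem_iff_mem _ hx).1 h)
  · have hx' : IsUnit (x - 1) := by
      by_contra hx'
      have := sub_mem ((IsLocalRing.mem_maximalIdeal _).2 hx)
        ((IsLocalRing.mem_maximalIdeal _).2 hx')
      rw [show x + 1 - (x - 1) = 2 by ring] at this
      exact (IsLocalRing.mem_maximalIdeal _).1 this (isUnit_two hp)
    rw [mul_comm] at h
    exact Or.inr ((Ideal.unit_mul_mem_iff_mem _ hx').1 h)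

/-- The nontrivial element of the center of `SL₂(R)`. -/
def negOne (k : Type*) [Field k] [ValuativeRel k] [TopologicalSpace k]
    [IsNonarchimedeanLocalField k] : SL(2, 𝒪[k]) :=
  slOf (-1) 0 0 (-1) (by ring)

lemma negOne_mul_00 (g : SL(2, 𝒪[k])) : (negOne k * g) 0 0 = -g 0 0 := by
  rw [mul_00]
  change -1 * g 0 0 + 0 * g 1 0 = _
  ring

lemma negOne_mul_10 (g : SL(2, 𝒪[k])) : (negOne k * g) 1 0 = -g 1 0 := by
  rw [mul_10]
  change 0 * g 0 0 + -1 * g 1 0 = _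
  ring

lemma negOne_mul_self : negOne k * negOne k = 1 := by
  apply Subtype.ext
  change !![(-1 : 𝒪[k]), 0; 0, -1] * !![(-1 : 𝒪[k]), 0; 0, -1] = 1
  rw [Matrix.mul_fin_two, Matrix.one_fin_two]
  simp

lemma mul_negOne_mul (g : SL(2, 𝒪[k])) : negOne k * (negOne k * g) = g := by
  rw [← mul_assoc, negOne_mul_self, one_mul]

lemma negOne_mem_center : negOne k ∈ Subgroup.center SL(2, 𝒪[k]) := by
  refine Matrix.SpecialLinearGroup.mem_center_iff.2 ⟨-1, by simp, ?_⟩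
  ext i j
  fin_cases i <;> fin_cases j <;> simp [negOne]

/-- The nontrivial element of the center of `SL₂(R)`, as an element of the center. -/
def centerNegOne (k : Type*) [Field k] [ValuativeRel k] [TopologicalSpace k]
    [IsNonarchimedeanLocalField k] : Subgroup.center SL(2, 𝒪[k]) := ⟨negOne k, negOne_mem_center⟩

lemma center_cases (z : Subgroup.center SL(2, 𝒪[k])) : z = 1 ∨ z = centerNegOne k := by
  obtain ⟨r, hr, h⟩ := Matrix.SpecialLinearGroup.mem_center_iff.1 z.2
  rw [Fintype.card_fin] at hr
  rcases mul_self_eq_one_iff.1 ((sq r).symm.trans hr) with rfl | rfl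
  · left
    apply Subtype.ext
    apply Subtype.ext
    rw [← h]
    simp
  · right
    apply Subtype.ext
    apply Subtype.ext
    rw [← h]
    ext i j
    fin_cases i <;> fin_cases j <;> simp [centerNegOne, negOne]

lemma center_sq (θ : Subgroup.center SL(2, 𝒪[k]) →* ℂˣ) : (θ (centerNegOne k) : ℂ) ^ 2 = 1 := by
  have : centerNegOne k ^ 2 = 1 := by
    rw [sq]
    exact Subtype.ext negOne_mul_self
  rw [← Units.val_pow_eq_pow_val, ← map_pow, this, map_one, Units.val_one]

/-- Two characters given by the same formula on the elements congruent to the identity, and with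
the same value at `-1`, agree. -/
lemma eq_of_formula (hp : ringChar 𝓀[k] ≠ 2) {H S : Subgroup SL(2, 𝒪[k])} {χ : H →* ℂˣ}
    {μ : S →* ℂˣ} {n : ℕ} {φ : SL(2, 𝒪[k]) → ℂ}
    (hχ : ∀ g (hg : g ∈ H), g 0 0 - 1 ∈ 𝓂[k] ^ n → (χ ⟨g, hg⟩ : ℂ) = φ g)
    (hμ : ∀ g (hg : g ∈ S), g 0 0 - 1 ∈ 𝓂[k] ^ n → (μ ⟨g, hg⟩ : ℂ) = φ g)
    (hS : ∀ g ∈ S, g 0 0 ^ 2 - 1 ∈ 𝓂[k] ^ n)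
    (hH1 : negOne k ∈ H) (hS1 : negOne k ∈ S) (h1 : χ ⟨negOne k, hH1⟩ = μ ⟨negOne k, hS1⟩)
    (g : SL(2, 𝒪[k])) (hgH : g ∈ H) (hgS : g ∈ S) : χ ⟨g, hgH⟩ = μ ⟨g, hgS⟩ := by
  rcases sub_one_mem_or hp (hS g hgS) with h | h
  · exact Units.ext ((hχ g hgH h).trans (hμ g hgS h).symm)
  · have h' : (negOne k * g) 0 0 - 1 ∈ 𝓂[k] ^ n := by
      rw [negOne_mul_00, show -g 0 0 - 1 = -(g 0 0 + 1) by ring]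
      exact neg_mem h
    have e1 : (⟨g, hgH⟩ : H) = ⟨negOne k, hH1⟩ * ⟨negOne k * g, H.mul_mem hH1 hgH⟩ :=
      Subtype.ext (mul_negOne_mul g).symm
    have e2 : (⟨g, hgS⟩ : S) = ⟨negOne k, hS1⟩ * ⟨negOne k * g, S.mul_mem hS1 hgS⟩ :=
      Subtype.ext (mul_negOne_mul g).symm
    rw [e1, e2, map_mul, map_mul, h1]
    congr 1
    exact Units.ext ((hχ _ _ h').trans (hμ _ _ h').symm)

end Center

/-! ### The group T(X)J and its character for nilpotent X. -/

section Shalika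

variable {k : Type*} [Field k] [ValuativeRel k] [TopologicalSpace k] [IsNonarchimedeanLocalField k]
  {ϖ : 𝒪[k]} {d : ℕ} {u : k}

lemma centralizer_nilp_entries (hu : u ≠ 0) {g : SL(2, 𝒪[k])} (hg : g ∈ centralizer (antidiag u 0)) :
    g 1 0 = 0 ∧ g 0 0 = g 1 1 ∧ g 0 0 ^ 2 = 1 := by
  have h := mem_centralizer_antidiag.1 hg
  have h10 : g 1 0 = 0 := by
    have := h.1
    rw [mul_zero, eq_comm, mul_eq_zero] at this
    exact Subtype.ext (this.resolve_left hu)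
  have h11 : g 0 0 = g 1 1 := by
    have := h.2.1
    rw [mul_comm] at this
    exact Subtype.ext (mul_left_cancel₀ hu this)
  refine ⟨h10, h11, ?_⟩
  have := det_eq g
  rw [h10, ← h11] at this
  linear_combination this

lemma negOne_mem_centralizer : negOne k ∈ centralizer (antidiag u 0) := by
  rw [mem_centralizer_antidiag]
  refine ⟨?_, ?_, ?_⟩
  · change ((0 : 𝒪[k]) : k) * 0 = u * ((0 : 𝒪[k]) : k)
    simp
  · exact mul_comm _ _
  · exact mul_comm _ _

/-- The upper triangular unipotent matrix with upper right entry `b`. -/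
def upperUnip (b : 𝒪[k]) : SL(2, 𝒪[k]) := slOf 1 b 0 1 (by ring)

lemma upperUnip_mem_centralizer (b : 𝒪[k]) : upperUnip b ∈ centralizer (antidiag u 0) := by
  rw [mem_centralizer_antidiag]
  refine ⟨?_, ?_, ?_⟩
  · change (b : k) * 0 = u * ((0 : 𝒪[k]) : k)
    simp
  · exact mul_comm _ _
  · exact mul_comm _ _

/-- An element with diagonal entries close to `1` is the product of an upper unipotent matrix and
an element of `levelGroup k d`. -/
lemma exists_upper_mul {g : SL(2, 𝒪[k])} (h10 : g 1 0 ∈ 𝓂[k] ^ ((d + 2) / 2))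
    (h00 : g 0 0 - 1 ∈ 𝓂[k] ^ ((d + 1) / 2)) :
    ∃ j ∈ levelGroup k d, upperUnip (g 0 1) * j = g ∧ j 1 0 = g 1 0 := by
  have hle : 𝓂[k] ^ ((d + 2) / 2) ≤ 𝓂[k] ^ ((d + 1) / 2) := Ideal.pow_le_pow_right (by omega)
  have hdet := det_eq g
  have h11 : g 1 1 - 1 ∈ 𝓂[k] ^ ((d + 1) / 2) := by
    rw [show g 1 1 - 1 = g 0 1 * g 1 0 - g 1 1 * (g 0 0 - 1) by linear_combination hdet]
    exact sub_mem (Ideal.mul_mem_left _ _ (hle h10)) (Ideal.mul_mem_left _ _ h00)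
  have hdet' : (g 0 0 - g 0 1 * g 1 0) * g 1 1 - (g 0 1 - g 0 1 * g 1 1) * g 1 0 = 1 := by
    linear_combination hdet
  refine ⟨slOf _ _ _ _ hdet', ⟨?_, ?_, h10, h11⟩, ?_, rfl⟩
  · change g 0 0 - g 0 1 * g 1 0 - 1 ∈ _
    rw [show g 0 0 - g 0 1 * g 1 0 - 1 = g 0 0 - 1 - g 0 1 * g 1 0 by ring]
    exact sub_mem h00 (Ideal.mul_mem_left _ _ (hle h10))
  · change g 0 1 - g 0 1 * g 1 1 ∈ _
    rw [show g 0 1 - g 0 1 * g 1 1 = -g 0 1 * (g 1 1 - 1) by ring]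
    exact Ideal.mul_mem_left _ _ h11
  · apply Subtype.ext
    change !![(1 : 𝒪[k]), g 0 1; 0, 1] * !![g 0 0 - g 0 1 * g 1 0, g 0 1 - g 0 1 * g 1 1; g 1 0, g 1 1] = g.1
    rw [Matrix.mul_fin_two]
    ext i j
    fin_cases i <;> fin_cases j <;> simp

/-- Here T(X) = ZU. The factor U frees the upper right entry, and Z turns 1 + P^⌈d/2⌉ into ±1 +
P^⌈d/2⌉ on the diagonal. -/
lemma mem_shalikaGroup_iff (hp : ringChar 𝓀[k] ≠ 2) (hu : u ≠ 0)
    (hv : valuation k (0 : k) < valuation k u) (g : SL(2, 𝒪[k])) :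
    g ∈ shalikaGroup d hv ↔
      g 1 0 ∈ 𝓂[k] ^ ((d + 2) / 2) ∧ g 0 0 ^ 2 - 1 ∈ 𝓂[k] ^ ((d + 1) / 2) := by
  have hle : 𝓂[k] ^ ((d + 2) / 2) ≤ 𝓂[k] ^ ((d + 1) / 2) := Ideal.pow_le_pow_right (by omega)
  constructor
  · rintro ⟨t, ht, j, ⟨h00, -, h10, -⟩, rfl⟩
    obtain ⟨t10, t11, tsq⟩ := centralizer_nilp_entries hu ht
    constructor
    · rw [mul_10, t10, zero_mul, zero_add]
      exact Ideal.mul_mem_left _ _ h10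
    · rw [mul_00, show (t 0 0 * j 0 0 + t 0 1 * j 1 0) ^ 2 - 1 = (j 0 0 + 1) * (j 0 0 - 1) +
        (2 * t 0 0 * j 0 0 * t 0 1 + t 0 1 ^ 2 * j 1 0) * j 1 0 by
          linear_combination j 0 0 ^ 2 * tsq]
      exact add_mem (Ideal.mul_mem_left _ _ h00) (Ideal.mul_mem_left _ _ (hle h10))
  · rintro ⟨h10, h00⟩
    rcases sub_one_mem_or hp h00 with h | h
    · obtain ⟨j, hj, e, -⟩ := exists_upper_mul h10 h
      exact ⟨_, upperUnip_mem_centralizer _, j, hj, e⟩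
    · obtain ⟨j, hj, e, -⟩ := exists_upper_mul (d := d) (g := negOne k * g)
        (by rw [negOne_mul_10]; exact neg_mem h10)
        (by
          rw [negOne_mul_00, show -g 0 0 - 1 = -(g 0 0 + 1) by ring]
          exact neg_mem h)
      refine ⟨negOne k * upperUnip ((negOne k * g) 0 1), (centralizer _).mul_mem negOne_mem_centralizer
        (upperUnip_mem_centralizer _), j, hj, ?_⟩
      rw [mul_assoc, e, mul_negOne_mul]

lemma negOne_mem_shalikaGroup (hv : valuation k (0 : k) < valuation k u) :
    negOne k ∈ shalikaGroup d hv :=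
  ⟨negOne k, negOne_mem_centralizer, 1, (levelGroup k d).one_mem, mul_one _⟩

variable (Ψ : AddChar k ℂ) (hΨ : IsBasic Ψ) (hϖ : Irreducible ϖ)
  (hu : valuation k u = valuation k (ϖ : k) ^ (-(d : ℤ)))
  (hv : valuation k (0 : k) < valuation k u) (hu0 : u ≠ 0)
  (θ : Subgroup.center SL(2, 𝒪[k]) →* ℂˣ)
  (hθ : ∀ g : centralizer (antidiag u 0), (g : SL(2, 𝒪[k])) ∈ levelGroup k d →
    (θ.comp (toCenter hu0) g : ℂ) = psiFun Ψ (antidiag u 0) g)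

/-- Splitting off an upper unipotent on the left costs nothing: the extension of θ is trivial on U,
and the bottom row, hence the value of Ψ_X, is unchanged. -/
lemma shalikaChar_formula (g : SL(2, 𝒪[k])) (hg : g ∈ shalikaGroup d hv)
    (h10 : g 1 0 ∈ 𝓂[k] ^ ((d + 2) / 2)) (h00 : g 0 0 - 1 ∈ 𝓂[k] ^ ((d + 1) / 2)) :
    (shalikaChar Ψ hΨ hϖ hu hv (θ.comp (toCenter hu0)) hθ ⟨g, hg⟩ : ℂ) =
      Ψ (u * (g 1 0 : 𝒪[k])) := by
  obtain ⟨j, hj, e, ej⟩ := exists_upper_mul h10 h00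
  have hc : toCenter hu0 ⟨_, upperUnip_mem_centralizer (g 0 1)⟩ = 1 := by
    apply Subtype.ext
    apply Subtype.ext
    rw [toCenter_apply]
    ext i j
    fin_cases i <;> fin_cases j <;> simp [upperUnip]
  have h1 : (θ.comp (toCenter hu0) ⟨_, upperUnip_mem_centralizer (g 0 1)⟩ : ℂ) *
      psiFun Ψ (antidiag u 0) j = Ψ (u * (g 1 0 : 𝒪[k])) := by
    rw [MonoidHom.comp_apply, hc, map_one, Units.val_one, one_mul, psiFun_antidiag, zero_mul,
      add_zero, ej]
  rw [← h1]
  refine Eq.trans ?_ (shalikaChar_apply Ψ hΨ hϖ hu hv (θ.comp (toCenter hu0)) hθ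
    ⟨_, upperUnip_mem_centralizer (g 0 1)⟩ ⟨j, hj⟩)
  congr 3
  exact e.symm

lemma shalikaChar_negOne :
    shalikaChar Ψ hΨ hϖ hu hv (θ.comp (toCenter hu0)) hθ ⟨negOne k, negOne_mem_shalikaGroup hv⟩ =
      θ (centerNegOne k) := by
  have hc : toCenter hu0 ⟨_, negOne_mem_centralizer⟩ = centerNegOne k := by
    apply Subtype.ext
    apply Subtype.ext
    rw [toCenter_apply]
    ext i j
    fin_cases i <;> fin_cases j <;> simp [negOne, centerNegOne]
  have h1 : (θ.comp (toCenter hu0) ⟨_, negOne_mem_centralizer⟩ : ℂ) *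
      psiFun Ψ (antidiag u 0) (1 : SL(2, 𝒪[k])) = θ (centerNegOne k) := by
    rw [MonoidHom.comp_apply, hc]
    simp [psiFun]
  apply Units.ext
  rw [← h1]
  refine Eq.trans ?_ (shalikaChar_apply Ψ hΨ hϖ hu hv (θ.comp (toCenter hu0)) hθ
    ⟨_, negOne_mem_centralizer⟩ 1)
  congr 3
  exact (mul_one _).symm

/-- The instance m = ⌈(d+1)/2⌉, n = ⌈d/2⌉ of the level criterion; these add up to d + 1. -/
lemma shalikaNilp_isIrreducible (hp : ringChar 𝓀[k] ≠ 2) (hd : 0 < d) (a : 𝒪[k]ˣ) :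
    (shalikaNilp hp Ψ hΨ hϖ hd θ a).IsIrreducible :=
  have hS := mem_shalikaGroup_iff (d := d) hp (unifPow_ne hϖ a) (valuation_zero_lt hϖ a)
  ind_isIrreducible_of_level hp hϖ hΨ a (by omega) (by omega) (by omega) _ _ hS
    fun g hg h => shalikaChar_formula Ψ hΨ hϖ _ _ (unifPow_ne hϖ a) θ _ g hg ((hS g).1 hg).1 h

end Shalika

/-! ### Comparison of π_d^±(θ) with Shalika's representations. -/

section Pi

variable {k : Type*} [Field k] [ValuativeRel k] [TopologicalSpace k] [IsNonarchimedeanLocalField k]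
  {ϖ : 𝒪[k]} {d : ℕ}

variable (k) in
/-- The subgroup of the matrices with lower left entry in `P^d` and diagonal entries in `±1 + P`. -/
def unipotentLevel (hd : 0 < d) : Subgroup SL(2, 𝒪[k]) where
  carrier := {g | g 1 0 ∈ 𝓂[k] ^ d ∧ g 0 0 ^ 2 - 1 ∈ 𝓂[k]}
  one_mem' := by simp
  mul_mem' := by
    rintro g h ⟨g1, g2⟩ ⟨h1, h2⟩
    have h1' := Ideal.pow_le_self hd.ne' h1
    refine ⟨(bK k d).mul_mem g1 h1, ?_⟩
    rw [mul_00, show (g 0 0 * h 0 0 + g 0 1 * h 1 0) ^ 2 - 1 = h 0 0 ^ 2 * (g 0 0 ^ 2 - 1) +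
      (h 0 0 ^ 2 - 1) + (2 * g 0 0 * h 0 0 * g 0 1 + g 0 1 ^ 2 * h 1 0) * h 1 0 by ring]
    exact add_mem (add_mem (Ideal.mul_mem_left _ _ g2) h2) (Ideal.mul_mem_left _ _ h1')
  inv_mem' := by
    rintro g ⟨g1, g2⟩
    have g1' := Ideal.pow_le_self hd.ne' g1
    refine ⟨(bK k d).inv_mem g1, ?_⟩
    rw [inv_00, show g 1 1 ^ 2 - 1 = -(g 1 1 ^ 2) * (g 0 0 ^ 2 - 1) +
      (g 0 1 * (2 + g 0 1 * g 1 0)) * g 1 0 by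
        linear_combination (g 0 0 * g 1 1 + 1 + g 0 1 * g 1 0) * det_eq g]
    exact add_mem (Ideal.mul_mem_left _ _ g2) (Ideal.mul_mem_left _ _ g1')

lemma unipotentLevel_le (hd : 0 < d) : unipotentLevel k hd ≤ bK k d := fun _ hg => hg.1

lemma congruenceGroup_le (hd : 0 < d) : congruenceGroup k d ≤ unipotentLevel k hd := by
  intro g hg
  obtain ⟨h1, h2⟩ := congruenceGroup_entries hg
  refine ⟨h2, ?_⟩
  rw [show g 0 0 ^ 2 - 1 = (g 0 0 + 1) * (g 0 0 - 1) by ring]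
  exact Ideal.mul_mem_left _ _ (Ideal.pow_le_self hd.ne' h1)

instance (hd : 0 < d) : (unipotentLevel k hd).FiniteIndex :=
  Subgroup.finiteIndex_of_le (congruenceGroup_le hd)

lemma negOne_mem_unipotentLevel (hd : 0 < d) : negOne k ∈ unipotentLevel k hd := by
  refine ⟨zero_mem _, ?_⟩
  change (-1 : 𝒪[k]) ^ 2 - 1 ∈ _
  simp

lemma reduction_apply (g : SL(2, 𝒪[k])) (i j : Fin 2) :
    reduction g i j = IsLocalRing.residue 𝒪[k] (g i j) := rfl

lemma etaConj_01 (hϖ : Irreducible ϖ) (hd : 0 < d) (g : bK k d) :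
    reduction (etaConj hϖ d g) 0 1 = 0 := by
  rw [reduction_apply, IsLocalRing.residue_eq_zero_iff]
  change ϖ ^ d * _ ∈ _
  rw [← pow_one 𝓂[k]]
  exact pow_mul_mem hϖ hd _

lemma etaConj_11 (hϖ : Irreducible ϖ) (g : bK k d) :
    reduction (etaConj hϖ d g) 1 1 = IsLocalRing.residue 𝒪[k] ((g : SL(2, 𝒪[k])) 1 1) := rfl

lemma etaConj_10 (hϖ : Irreducible ϖ) (g : bK k d) :
    (g : SL(2, 𝒪[k])) 1 0 = ϖ ^ d * (etaConj hϖ d g) 1 0 := (bK_dvd hϖ g).choose_spec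

lemma tauExt_val (hd : 0 < d) (τ : 𝓀[k]ˣ →* ℂˣ) (g : bK k d) (c : 𝓀[k]ˣ)
    (hc : IsLocalRing.residue 𝒪[k] ((g : SL(2, 𝒪[k])) 0 0) = c) : tauExt hd τ g = τ c := by
  change τ _ = _
  congr 1
  exact Units.ext hc

variable {κ' : Type*} [Field κ'] [Fintype κ'] [Algebra 𝓀[k] κ']
  [Algebra.IsQuadraticExtension 𝓀[k] κ']

lemma sigma_negOne (Ψ : AddChar k ℂ) (hΨ : IsBasic Ψ) (ω₀ : normKer 𝓀[k] κ' →* ℂˣ)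
    (f : (sigma (residueChar Ψ hΨ) (residueChar_ne_one Ψ hΨ) ω₀).toSubmodule) :
    (sigma (residueChar Ψ hΨ) (residueChar_ne_one Ψ hΨ) ω₀).toRepresentation
      (reduction (negOne k)) f = (ω₀ (negOneKer 𝓀[k] κ') : ℂ) • f := by
  apply Subtype.ext
  funext x
  have h10 : reduction (negOne k) 1 0 = 0 := map_zero (IsLocalRing.residue 𝒪[k])
  have h01 : reduction (negOne k) 0 1 = 0 := map_zero (IsLocalRing.residue 𝒪[k])
  have h00 : reduction (negOne k) 0 0 = -1 := by
    refine (map_neg (IsLocalRing.residue 𝒪[k]) 1).trans ?_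
    rw [map_one]
  refine (weilOp_of_eq h10 f.1 x).trans ?_
  rw [h01, h00, mul_zero, zero_mul, AddChar.map_zero_eq_one, one_mul, map_neg, map_one, neg_one_mul,
    ← negOneKer_mul (F := 𝓀[k])]
  exact f.2 (negOneKer 𝓀[k] κ') x

/-- The center is {±1}, and -1 acts on σ₀ by f(x) ↦ f(-x), that is, by ω₀(-1). A nonvanishing value
is needed to compare the scalars. -/
lemma isCentralChar_iff (Ψ : AddChar k ℂ) (hΨ : IsBasic Ψ) (ω₀ : normKer 𝓀[k] κ' →* ℂˣ)
    (θ : Subgroup.center SL(2, 𝒪[k]) →* ℂˣ)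
    (hne : ∃ f ∈ (sigma (residueChar Ψ hΨ) (residueChar_ne_one Ψ hΨ) ω₀).toSubmodule,
      ∃ x, f x ≠ 0) :
    IsCentralChar Ψ hΨ ω₀ θ ↔ (θ (centerNegOne k) : ℂ) = ω₀ (negOneKer 𝓀[k] κ') := by
  constructor
  · intro h
    obtain ⟨f, hf, x, hx⟩ := hne
    have h1 := congrArg (fun A => (A ⟨f, hf⟩).1 x) (h (centerNegOne k))
    change (((sigma (residueChar Ψ hΨ) (residueChar_ne_one Ψ hΨ) ω₀).toRepresentation
      (reduction (negOne k))) ⟨f, hf⟩).1 x = θ (centerNegOne k) * f x at h1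
    rw [sigma_negOne] at h1
    exact (mul_right_cancel₀ hx h1).symm
  · intro h z
    rcases center_cases z with rfl | rfl
    · rw [map_one, Units.val_one, one_smul, OneMemClass.coe_one, map_one, map_one]
      rfl
    · apply LinearMap.ext
      intro f
      rw [h]
      exact sigma_negOne Ψ hΨ ω₀ f

/-- The representations `π_d^±(θ)` are equivalent to the representations `S_d(θ, X)`. -/
theorem pi_equiv_shalika (hp : ringChar 𝓀[k] ≠ 2) (hϖ : Irreducible ϖ)
    (Ψ : AddChar k ℂ) (hΨ : IsBasic Ψ)
    (ω₀ : normKer 𝓀[k] κ' →* ℂˣ) (hω : ω₀ ≠ 1) (hω2 : ω₀ ^ 2 = 1)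
    (τ : 𝓀[k]ˣ →* ℂˣ) (hτ : τ (-1) = -1) (hd : 0 < d) (θ : Subgroup.center SL(2, 𝒪[k]) →* ℂˣ)
    (s : ℤˣ) (a : 𝒪[k]ˣ) (ha : HasSign s (IsLocalRing.residue 𝒪[k] a)) :
    Nonempty ((Ind (bK k d) (piInducing hp Ψ hΨ hϖ ω₀ hω hω2 τ hd θ s)).Equiv
      (shalikaNilp hp Ψ hΨ hϖ hd θ (-a))) := by
  -- The base point has norm a modulo P. Lower unipotents then act on the functional by ψ(-c a),
  -- which is the source of the sign in X(-a ϖ^(-d), 0).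
  obtain ⟨x₀, hx₀⟩ := FiniteField.norm_surjective 𝓀[k] κ' (IsLocalRing.residue 𝒪[k] a)
  rw [← hx₀] at ha
  set ψ := residueChar Ψ hΨ
  have hψ : ψ ≠ 1 := residueChar_ne_one Ψ hΨ
  obtain ⟨w₀, hw₀⟩ := exists_sigmaHalf_ne hψ hp hω hω2 ha
  have hcentral := isCentralChar_iff Ψ hΨ ω₀ θ ⟨w₀.1, w₀.2.1, x₀, hw₀⟩
  have hnt : Nontrivial (sigmaHalf (E := κ') ψ hψ hp ω₀ hω hω2 s).toSubmodule :=
    ⟨w₀, 0, fun h => hw₀ (by rw [h]; rfl)⟩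
  set l := weylFunctional (s := s) hψ hp hω hω2 x₀ with hl
  obtain ⟨tw, htw⟩ : ∃ tw : bK k d →* ℂˣ,
    (open Classical in if IsCentralChar Ψ hΨ ω₀ θ then 1 else tauExt hd τ) = tw := ⟨_, rfl⟩
  have hρ : ∀ (b : bK k d) w, weylFunctional hψ hp hω hω2 x₀
      (piInducing hp Ψ hΨ hϖ ω₀ hω hω2 τ hd θ s b w) =
      tw b * (ψ (-(IsLocalRing.residue 𝒪[k] ((b : SL(2, 𝒪[k])) 1 1 * etaConj hϖ d b 1 0 * a))) *
        weylFunctional hψ hp hω hω2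
          (algebraMap _ _ (IsLocalRing.residue 𝒪[k] ((b : SL(2, 𝒪[k])) 1 1)) * x₀) w) := by
    intro b w
    have h := weylFunctional_lower hψ hp hω hω2 x₀ (etaConj_01 hϖ hd b) w
    rw [etaConj_11, hx₀, reduction_apply, ← map_mul, ← map_mul] at h
    rw [← h, ← htw]
    exact map_smul (weylFunctional hψ hp hω hω2 x₀) _ _
  have hdet : ∀ b : bK k d, IsLocalRing.residue 𝒪[k] ((b : SL(2, 𝒪[k])) 0 0) *
      IsLocalRing.residue 𝒪[k] ((b : SL(2, 𝒪[k])) 1 1) = 1 := by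
    intro b
    have h := congrArg (IsLocalRing.residue 𝒪[k]) (det_eq (b : SL(2, 𝒪[k])))
    rw [map_sub, map_mul, map_mul, (IsLocalRing.residue_eq_zero_iff _).2
      (Ideal.pow_le_self hd.ne' b.2), mul_zero, sub_zero, map_one] at h
    exact h
  have hsep : ∀ w, (∀ b, l (piInducing hp Ψ hΨ hϖ ω₀ hω hω2 τ hd θ s b w) = 0) → w = 0 := by
    intro w hw
    refine eq_zero_of_weylFunctional hψ hp hω hω2 ha w fun c hc => ?_
    obtain ⟨y, rfl⟩ := IsLocalRing.residue_surjective c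
    have hy : IsUnit y := by
      by_contra hy
      exact hc ((IsLocalRing.residue_eq_zero_iff _).2 ((IsLocalRing.mem_maximalIdeal _).2 hy))
    obtain ⟨y, rfl⟩ := hy
    -- Diagonal elements of B_d move x₀ to an arbitrary multiple c x₀. The twist contributes only a
    -- nonzero scalar.
    have h := hw ⟨slOf (y⁻¹ : 𝒪[k]ˣ) 0 0 y (by simp), show (0 : 𝒪[k]) ∈ 𝓂[k] ^ d from zero_mem _⟩
    rw [hl, hρ] at h
    exact ((mul_eq_zero.1 h).resolve_left (Units.ne_zero _) |> mul_eq_zero.1).resolve_left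
      (AddChar.val_isUnit ψ _).ne_zero
  have hl0 : l ≠ 0 := by
    intro h
    obtain ⟨w, hw⟩ := exists_ne (0 : (sigmaHalf (E := κ') ψ hψ hp ω₀ hω hω2 s).toSubmodule)
    exact hw (hsep w fun b => by rw [h]; rfl)
  have hone : ∀ (b : bK k d), (b : SL(2, 𝒪[k])) 0 0 - 1 ∈ 𝓂[k] → ∀ w,
      l (piInducing hp Ψ hΨ hϖ ω₀ hω hω2 τ hd θ s b w) =
        Ψ (unifPow ϖ d (-a) * ((b : SL(2, 𝒪[k])) 1 0 : 𝒪[k])) * l w := by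
    intro b hb w
    have h00 : IsLocalRing.residue 𝒪[k] ((b : SL(2, 𝒪[k])) 0 0) = 1 := by
      rwa [← IsLocalRing.residue_eq_zero_iff, map_sub, map_one, sub_eq_zero] at hb
    have h11 : IsLocalRing.residue 𝒪[k] ((b : SL(2, 𝒪[k])) 1 1) = 1 := by
      have := hdet b
      rwa [h00, one_mul] at this
    -- The twist sees only g₁₁ modulo P, so it is invisible where g₁₁ ≡ 1.
    have htw1 : tw b = 1 := by
      rw [← htw]
      split_ifs
      · rfl
      · rw [tauExt_val hd τ b 1 (by rw [h00, Units.val_one]), map_one]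
    rw [hl, hρ, htw1, Units.val_one, one_mul, h11, map_one, one_mul, etaConj_10 hϖ b, unifPow_mul hϖ,
      ← residueChar_residue Ψ hΨ]
    congr 2
    simp only [map_mul, h11, one_mul, Units.val_neg, map_neg, neg_mul]
    rw [mul_comm]
  have hneg : ∀ w, l (piInducing hp Ψ hΨ hϖ ω₀ hω hω2 τ hd θ s
      ⟨negOne k, unipotentLevel_le hd (negOne_mem_unipotentLevel hd)⟩ w) =
        θ (centerNegOne k) * l w := by
    intro w
    set b : bK k d := ⟨negOne k, unipotentLevel_le hd (negOne_mem_unipotentLevel hd)⟩ with hb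
    have h00 : IsLocalRing.residue 𝒪[k] ((b : SL(2, 𝒪[k])) 0 0) = -1 := by
      refine (map_neg (IsLocalRing.residue 𝒪[k]) 1).trans ?_
      rw [map_one]
    have h11 : IsLocalRing.residue 𝒪[k] ((b : SL(2, 𝒪[k])) 1 1) = -1 := h00
    have h10 : etaConj hϖ d b 1 0 = 0 := by
      have h := etaConj_10 hϖ b
      exact (mul_eq_zero.1 h.symm).resolve_left (pow_ne_zero _ hϖ.ne_zero)
    rw [hl, hρ, h10, mul_zero, zero_mul, map_zero, neg_zero, AddChar.map_zero_eq_one, one_mul, h11,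
      map_neg, map_one, neg_one_mul, weylFunctional_neg, ← mul_assoc]
    congr 1
    rw [← htw]
    -- Both θ(-1) and ω₀(-1) are signs. If they differ, they are opposite, and τ(-1) = -1 corrects
    -- the discrepancy.
    by_cases hc : IsCentralChar Ψ hΨ ω₀ θ
    · rw [if_pos hc, hcentral.1 hc]
      simp
    · rw [if_neg hc, tauExt_val hd τ b (-1) (by rw [h00]; simp), hτ]
      have h1 := center_sq θ
      rw [← omega_negOneKer_sq (ω := ω₀), sq_eq_sq_iff_eq_or_eq_neg] at h1
      rw [h1.resolve_left fun h => hc (hcentral.2 h)]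
      simp
  -- For g in this group, g or -g has diagonal ≡ 1 modulo P, so the two preceding formulas give the
  -- scalar by which g acts. Multiplicativity then comes for free from the nonzero functional.
  obtain ⟨χ, hχ⟩ := exists_char_of_functional
    ((piInducing hp Ψ hΨ hϖ ω₀ hω hω2 τ hd θ s).comp (Subgroup.inclusion (unipotentLevel_le hd))) hl0
    (by
      rintro ⟨g, hg⟩
      have hg2 := hg.2
      rw [← pow_one 𝓂[k]] at hg2
      rcases sub_one_mem_or hp hg2 with h | h
      · rw [pow_one] at h
        exact ⟨_, fun w => hone ⟨g, hg.1⟩ h w⟩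
      · rw [pow_one] at h
        have hg' : negOne k * g ∈ bK k d :=
          unipotentLevel_le hd (mul_mem (negOne_mem_unipotentLevel hd) hg)
        refine ⟨θ (centerNegOne k) * Ψ (unifPow ϖ d (-a) * ((negOne k * g) 1 0 : 𝒪[k])), fun w => ?_⟩
        have e : Subgroup.inclusion (unipotentLevel_le hd) ⟨g, hg⟩ =
          ⟨negOne k, unipotentLevel_le hd (negOne_mem_unipotentLevel hd)⟩ *
            (⟨negOne k * g, hg'⟩ : bK k d) := Subtype.ext (mul_negOne_mul g).symm
        rw [MonoidHom.comp_apply, e, map_mul, Module.End.mul_apply, hneg, hone _ (by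
          change (negOne k * g) 0 0 - 1 ∈ _
          rw [negOne_mul_00, show -g 0 0 - 1 = -(g 0 0 + 1) by ring]
          exact neg_mem h), ← mul_assoc])
  obtain ⟨w₁, hw₁⟩ : ∃ w, l w ≠ 0 := by
    by_contra! h
    exact hl0 (LinearMap.ext h)
  have hχ1 : ∀ g (hg : g ∈ unipotentLevel k hd), g 0 0 - 1 ∈ 𝓂[k] →
      (χ ⟨g, hg⟩ : ℂ) = Ψ (unifPow ϖ d (-a) * (g 1 0 : 𝒪[k])) := by
    intro g hg h
    apply mul_right_cancel₀ hw₁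
    rw [← hχ]
    exact hone ⟨g, hg.1⟩ h w₁
  have hχneg : χ ⟨negOne k, negOne_mem_unipotentLevel hd⟩ = θ (centerNegOne k) := by
    apply Units.ext
    apply mul_right_cancel₀ hw₁
    rw [← hχ]
    exact hneg w₁
  have hirr : (Ind (unipotentLevel k hd) (charRep χ)).IsIrreducible :=
    -- The other extreme of the level criterion: the largest m and the smallest n.
    ind_isIrreducible_of_level (m := d) (n := 1) hp hϖ hΨ (-a) rfl one_pos hd _ _
      (fun g => by rw [pow_one]; rfl) (fun g hg h => hχ1 g hg (by rwa [pow_one] at h))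
  obtain ⟨e₁⟩ := ind_equiv_of_functional (unipotentLevel_le hd)
    (piInducing hp Ψ hΨ hϖ ω₀ hω hω2 τ hd θ s) χ l hχ hsep hirr
  have hu : unifPow ϖ d (-a) ≠ 0 := unifPow_ne hϖ (-a)
  have hv : valuation k (0 : k) < valuation k (unifPow ϖ d (-a)) := valuation_zero_lt hϖ (-a)
  have hS := mem_shalikaGroup_iff (d := d) hp hu hv
  let μ := shalikaChar Ψ hΨ hϖ (valuation_unifPow (d := d) (-a)) hv
    (θ.comp (toCenter hu)) (theta_compat hp hd Ψ hu θ)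
  have hμ1 : ∀ g (hg : g ∈ shalikaGroup d hv),
      g 0 0 - 1 ∈ 𝓂[k] ^ ((d + 1) / 2) →
      (μ ⟨g, hg⟩ : ℂ) = Ψ (unifPow ϖ d (-a) * (g 1 0 : 𝒪[k])) := fun g hg h =>
    shalikaChar_formula Ψ hΨ hϖ _ _ hu θ _ g hg ((hS g).1 hg).1 h
  -- The comparison takes place at the finer level ⌈d/2⌉ of S, where the formula for χ, valid
  -- already modulo P, holds a fortiori.
  have hagree := eq_of_formula hp (χ := χ) (μ := μ)
    (fun g hg h => hχ1 g hg (Ideal.pow_le_self (by omega) h)) hμ1 (fun g hg => ((hS g).1 hg).2)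
    (negOne_mem_unipotentLevel hd) (negOne_mem_shalikaGroup hv)
    (hχneg.trans (shalikaChar_negOne ..).symm)
  obtain ⟨e₂⟩ := ind_equiv_of_agree _ _ χ μ hagree hirr
    (shalikaNilp_isIrreducible Ψ hΨ hϖ θ hp hd (-a))
  exact ⟨e₁.trans e₂⟩

end Pi

/-! ### Squares of units and their residues. -/

section Hensel

variable {k : Type*} [Field k] [ValuativeRel k] [TopologicalSpace k] [IsNonarchimedeanLocalField k]

/-- A unit which is a square in the residue field, of odd characteristic, is a square. -/
lemma isSquare_of_residue (hp : ringChar 𝓀[k] ≠ 2) {x : 𝒪[k]ˣ}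
    (hx : IsSquare (IsLocalRing.residue 𝒪[k] x)) : IsSquare x := by
  -- The uniform structure of the additive group of k is what the Henselian property of R is derived
  -- from.
  let _ := IsTopologicalAddGroup.rightUniformSpace k
  have := isUniformAddGroup_of_addCommGroup (G := k)
  have : HenselianRing 𝒪[k] 𝓂[k] := inferInstance
  obtain ⟨c, hc⟩ := hx
  obtain ⟨y, rfl⟩ := IsLocalRing.residue_surjective c
  have hxy : y ^ 2 - x ∈ 𝓂[k] := by
    rw [← IsLocalRing.residue_eq_zero_iff, map_sub, hc, map_pow]
    ring
  have hy : IsUnit y := by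
    by_contra hy
    have h1 := Ideal.mul_mem_left _ y ((IsLocalRing.mem_maximalIdeal _).2 hy)
    have h2 := sub_mem h1 hxy
    rw [show y * y - (y ^ 2 - x) = x by ring] at h2
    exact (IsLocalRing.mem_maximalIdeal _).1 h2 x.isUnit
  -- Hensel's lemma for T² - x at y: the derivative 2y is a unit, because y² ≡ x and the residue
  -- characteristic is odd.
  obtain ⟨z, hz, -⟩ := HenselianRing.is_henselian (R := 𝒪[k]) (I := 𝓂[k])
    (Polynomial.X ^ 2 - Polynomial.C (x : 𝒪[k])) (Polynomial.monic_X_pow_sub_C _ two_ne_zero) y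
    (by simpa using hxy) (by
      refine IsUnit.map _ ?_
      simpa [one_add_one_eq_two] using (isUnit_two hp).mul hy)
  have hz' : z ^ 2 = x := by
    simpa [Polynomial.IsRoot, sub_eq_zero] using hz
  have hzu : IsUnit z := isUnit_of_mul_isUnit_left (y := z) (by rw [← sq, hz']; exact x.isUnit)
  obtain ⟨z, rfl⟩ := hzu
  refine ⟨z, Units.ext ?_⟩
  rw [← hz', sq, Units.val_mul]

end Hensel

end

end DepthZero

/-! ### The proposition. -/

theorem proposition5p2 {k : Type*} [Field k] [ValuativeRel k] [TopologicalSpace k]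
    [IsNonarchimedeanLocalField k] (hp : ringChar 𝓀[k] ≠ 2)
    (ϖ : 𝒪[k]) (hϖ : Irreducible ϖ) (ε : 𝒪[k]ˣ) (hε : ¬ IsSquare ε)
    (Ψ : AddChar k ℂ) (hΨ : IsBasic Ψ)
    {κ' : Type*} [Field κ'] [Fintype κ'] [Algebra 𝓀[k] κ'] [Algebra.IsQuadraticExtension 𝓀[k] κ']
    (ω₀ : normKer 𝓀[k] κ' →* ℂˣ) (hω : ω₀ ≠ 1) (hω2 : ω₀ ^ 2 = 1)
    (τ : 𝓀[k]ˣ →* ℂˣ) (hτ : τ (-1) = -1)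
    (d : ℕ) (hd : 0 < d) (θ : Subgroup.center SL(2, 𝒪[k]) →* ℂˣ) :
    Nonempty ((piPlus hp Ψ hΨ hϖ ω₀ hω hω2 τ hd θ).Equiv
        (shalikaNilp hp Ψ hΨ hϖ hd θ (-1))) ∧
      Nonempty ((piMinus hp Ψ hΨ hϖ ω₀ hω hω2 τ hd θ).Equiv
        (shalikaNilp hp Ψ hΨ hϖ hd θ (-ε))) ∧
      (piPlus hp Ψ hΨ hϖ ω₀ hω hω2 τ hd θ).IsIrreducible ∧
      (piMinus hp Ψ hΨ hϖ ω₀ hω hω2 τ hd θ).IsIrreducible := by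
  have h1 := pi_equiv_shalika hp hϖ Ψ hΨ ω₀ hω hω2 τ hτ hd θ 1 1
    ⟨by simp, by simp⟩
  -- By Hensel's lemma the residue of the nonsquare unit ε is a nonsquare, so it is the norm of a
  -- point in the support for σ₀^-.
  have h2 := pi_equiv_shalika hp hϖ Ψ hΨ ω₀ hω hω2 τ hτ hd θ (-1) ε
    ⟨(ε.isUnit.map (IsLocalRing.residue 𝒪[k])).ne_zero,
      ⟨fun h => absurd (isSquare_of_residue hp h) hε, fun h => absurd h (by decide)⟩⟩
  obtain ⟨e₁⟩ := h1
  obtain ⟨e₂⟩ := h2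
  exact ⟨⟨e₁⟩, ⟨e₂⟩,
    isIrreducible_of_equiv e₁ (shalikaNilp_isIrreducible Ψ hΨ hϖ θ hp hd (-1)),
    isIrreducible_of_equiv e₂ (shalikaNilp_isIrreducible Ψ hΨ hϖ θ hp hd (-ε))⟩
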